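/- Let $s\ge 1$, $m\ge t\ge 0$ and $r\ge 1$ be integers, $n=2^m$, and let $f:[0,1]^s\to\mathbb{R}$ be square integrable with $\mu=\int_{[0,1]^s}f(\boldsymbol{x})\,\mathrm{d}\boldsymbol{x}$. Let $C_1,\dots,C_s\in\{0,1\}^{m\times m}$ generate a digital $(t,m,s)$-net in base $2$. That is, for $0\le i<2^m$ let $\vec{i}=(i_1,\dots,i_m)^{\mathsf T}$ where $i=\sum_{\ell=1}^m i_\ell 2^{\ell-1}$, and let $\boldsymbol{a}_i\in[0,1)^s$ be the point whose $j$-th coordinate has the binary digits $C_j\vec{i}\bmod 2$; every elementary interval $\prod_{j=1}^s[c_j2^{-k_j},(c_j+1)2^{-k_j})$ with integers $k_j\ge0$, $0\le c_j<2^{k_j}$ and $\sum_j k_j=m-t$ contains exactly $2^t$ of the points $\boldsymbol{a}_0,\dots,\boldsymbol{a}_{n-1}$. Let $M_1,\dots,M_s\in\{0,1\}^{\infty\times m}$ be random lower triangular matrices with ones on the diagonal and let $D_1,\dots,D_s\in\{0,1\}^{\infty}$ be random vectors, where all the entries of the $M_j$ below the diagonal and all the entries of the $D_j$ are independent and uniform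 on $\{0,1\}$. Let $\boldsymbol{x}_i\in[0,1]^s$ be the point with coordinates $x_{ij}=\sum_{\ell\ge1}2^{-\ell}x_{ij\ell}$, where $(x_{ij\ell})_{\ell\ge1}=M_jC_j\vec{i}+D_j\bmod 2$, and put $\hat\mu_\infty=\frac1n\sum_{i=0}^{n-1}f(\boldsymbol{x}_i)$. Let $\delta>0$ and let $\mathcal{A}$ be an event in the underlying probability space with $\Pr(\mathcal{A})\le\delta$, $\Pr(\mathcal{A}^c)>0$ and $\mathbb{E}(\hat\mu_\infty\mid\mathcal{A}^c)=\mu$. Then the sample median $\hat\mu_\infty^{(r)}$ of $2r-1$ independent copies of $\hat\mu_\infty$ satisfies $$ \mathbb{E}\bigl((\hat\mu_\infty^{(r)}-\mu)^2\bigr)\le \frac{\Pr(\mathcal{A}^c)\,\mathrm{Var}(\hat\mu_\infty\mid\mathcal{A}^c)}{\delta}+(8\delta)^r\Delta_n^2, $$ where $$ \Delta_n=\min\Biggl(\sup_{\boldsymbol{x}\in[0,1]^s}f(\boldsymbol{x})-\inf_{\boldsymbol{x}\in[0,1]^s}f(\boldsymbol{x}),\ \frac{V_{\mathrm{HK}}(f)}{2^{m-t}}\sum_{i=0}^{s-1}\binom{m-t}{i}\Biggr)\in[0,\infty]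 $$ and $V_{\mathrm{HK}}(f)\in[0,\infty]$ is the total variation of $f$ in the sense of Hardy and Krause, i.e. the sum over nonempty $u\subseteq\{1,\dots,s\}$ of the Vitali variations over $[0,1]^u$ of $f$ with the coordinates outside $u$ fixed at $1$. -/

import Mathlib

open MeasureTheory ProbabilityTheory
open scoped ENNReal

noncomputable section

namespace MedianQMC

/-- The points `x 0, …, x (b ^ m - 1)` form a `(t, m, s)`-net in base `b`: they lie in `[0,1)^s`
and every elementary interval `∏ j, [c j / b ^ k j, (c j + 1) / b ^ k j)` with `∑ j, k j = m - t`
contains exactly `b ^ t` of them (counted with multiplicity). -/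
structure IsNet (b t m s : ℕ) (x : Fin (b ^ m) → Fin s → ℝ) : Prop where
  le : t ≤ m
  mem : ∀ i j, x i j ∈ Set.Ico (0 : ℝ) 1
  card : ∀ k c : Fin s → ℕ, ∑ j, k j = m - t → (∀ j, c j < b ^ k j) →
    Set.ncard {i | ∀ j, x i j ∈ Set.Ico ((c j : ℝ) / (b : ℝ) ^ k j)
      (((c j : ℝ) + 1) / (b : ℝ) ^ k j)} = b ^ t

/-- The vector of the `m` binary digits of `i`, least significant digit first. -/
def bits (m i : ℕ) : Fin m → ZMod 2 := fun l => if i.testBit l then 1 else 0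

/-- The points `a i` of the digital net with generator matrices `C j`: the binary digits of the
coordinate `a i j` are the entries of `C j * bits i` (mod 2). -/
def digitalPoint {s m : ℕ} (C : Fin s → Matrix (Fin m) (Fin m) (ZMod 2))
    (i : Fin (2 ^ m)) (j : Fin s) : ℝ :=
  ∑ l : Fin m, (((C j).mulVec (bits m i) l).val : ℝ) / 2 ^ ((l : ℕ) + 1)

/-- The matrices `C j` generate a digital `(t, m, s)`-net in base 2. -/
def IsDigitalNet {s m : ℕ} (t : ℕ) (C : Fin s → Matrix (Fin m) (Fin m) (ZMod 2)) : Prop :=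
  IsNet 2 t m s (digitalPoint C)

/-- Infinite precision scrambled points: the binary digits of the coordinate `x i j` are the
entries of `M j * C j * bits i + D j` (mod 2). Rows are numbered from `0`. -/
def scrambledPoint {s m : ℕ} (C : Fin s → Matrix (Fin m) (Fin m) (ZMod 2))
    (M : Fin s → Matrix ℕ (Fin m) (ZMod 2)) (D : Fin s → ℕ → ZMod 2)
    (i : Fin (2 ^ m)) (j : Fin s) : ℝ :=
  ∑' l : ℕ, (((M j * C j).mulVec (bits m i) l + D j l).val : ℝ) / 2 ^ (l + 1)

/-- The infinite precision estimate `(1 / n) ∑ i, f (x i)` with `n = 2 ^ m` scrambled points. -/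
def estimate {s m : ℕ} (f : (Fin s → ℝ) → ℝ) (C : Fin s → Matrix (Fin m) (Fin m) (ZMod 2))
    (M : Fin s → Matrix ℕ (Fin m) (ZMod 2)) (D : Fin s → ℕ → ZMod 2) : ℝ :=
  (1 / 2 ^ m) * ∑ i : Fin (2 ^ m), f (scrambledPoint C M D i)

/-- Positions of the random entries: those of the `M j` strictly below the diagonal, and all
entries of the `D j`. -/
abbrev RandomEntry (s m : ℕ) : Type :=
  {p : Fin s × ℕ × Fin m // (p.2.2 : ℕ) < p.2.1} ⊕ (Fin s × ℕ)

/-- The entry of `(M, D)` at a random position. -/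
def randomEntry {s m : ℕ} (M : Fin s → Matrix ℕ (Fin m) (ZMod 2)) (D : Fin s → ℕ → ZMod 2) :
    RandomEntry s m → ZMod 2
  | Sum.inl p => M p.1.1 p.1.2.1 p.1.2.2
  | Sum.inr q => D q.1 q.2

/-- Random linear scrambling with a digital shift, in infinite precision: each `M j` is lower
triangular with ones on the diagonal, and the entries below the diagonal together with all entries
of the `D j` are independent and uniform on `{0, 1}`. -/
structure IsRandomLinearScramble {s m : ℕ} {Ω : Type*} [MeasurableSpace Ω] (P : Measure Ω)
    (M : Ω → Fin s → Matrix ℕ (Fin m) (ZMod 2)) (D : Ω → Fin s → ℕ → ZMod 2) : Prop where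
  upper : ∀ ω j (l : ℕ) (k : Fin m), l < k → M ω j l k = 0
  diag : ∀ ω j (k : Fin m), M ω j k k = 1
  measurable : ∀ e, Measurable fun ω => randomEntry (M ω) (D ω) e
  uniform : ∀ e (b : ZMod 2), P {ω | randomEntry (M ω) (D ω) e = b} = 1 / 2
  indep : iIndepFun (fun e ω => randomEntry (M ω) (D ω) e) P

/-- The closed unit cube `[0,1]^s`. -/
def cube (s : ℕ) : Set (Fin s → ℝ) := Set.Icc 0 1

/-- `sup f - inf f` over the closed unit cube, as `sup_{x, y} (f x - f y)`; it is `∞` if `f` is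
unbounded there. -/
def oscillation {s : ℕ} (f : (Fin s → ℝ) → ℝ) : ℝ≥0∞ :=
  ⨆ x ∈ cube s, ⨆ y ∈ cube s, ENNReal.ofReal (f x - f y)

/-- The alternating sum of `f` over the vertices of the `u`-dimensional box
`∏ j ∈ u, [a j, b j]`, the coordinates outside `u` being fixed at `1`. -/
def increment {s : ℕ} (f : (Fin s → ℝ) → ℝ) (u : Finset (Fin s)) (a b : Fin s → ℝ) : ℝ :=
  ∑ v ∈ u.powerset, (-1 : ℝ) ^ (u \ v).card *
    f (fun j => if j ∈ v then b j else if j ∈ u then a j else 1)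

/-- The variation in the sense of Vitali over `[0,1]^u` of `f` with the coordinates outside `u`
fixed at `1`. The supremum is over grids `0 = g j 0 ≤ g j 1 ≤ … ≤ g j N = 1` (repeated knots only
add zero terms, so a common `N` is no restriction); the cells of the grid are indexed by
`i j < N` for `j ∈ u`, with `i j = 0` as a dummy value for `j ∉ u`. -/
def vitaliVariation {s : ℕ} (f : (Fin s → ℝ) → ℝ) (u : Finset (Fin s)) : ℝ≥0∞ :=
  ⨆ (N : ℕ) (g : {g : Fin s → ℕ → ℝ // ∀ j, Monotone (g j) ∧ g j 0 = 0 ∧ g j N = 1}),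
    ∑ i ∈ Fintype.piFinset (fun j => if j ∈ u then Finset.range N else {0}),
      ENNReal.ofReal |increment f u (fun j => g.1 j (i j)) (fun j => g.1 j (i j + 1))|

/-- The total variation in the sense of Hardy and Krause (anchored at `1`): the sum of the Vitali
variations over all nonempty sets of coordinates. -/
def hardyKrauseVariation {s : ℕ} (f : (Fin s → ℝ) → ℝ) : ℝ≥0∞ :=
  ∑ u : Finset (Fin s) with u.Nonempty, vitaliVariation f u

/-- The worst case error bound `Δ_n` for `(t, m, s)`-nets in base 2 (used for `t ≤ m`). -/
def errorBound (t m : ℕ) {s : ℕ} (f : (Fin s → ℝ) → ℝ) : ℝ≥0∞ :=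
  min (oscillation f)
    (hardyKrauseVariation f / 2 ^ (m - t) * ∑ i ∈ Finset.range s, ((m - t).choose i : ℝ≥0∞))

/-- The sample median of `2r - 1` numbers: the `r`-th smallest one. -/
def sampleMedian {r : ℕ} (hr : 0 < r) (x : Fin (2 * r - 1) → ℝ) : ℝ :=
  x (Tuple.sort x ⟨r - 1, by omega⟩)

end MedianQMC

end

/-! The bound combines a probabilistic argument about medians with a deterministic error bound valid
for every realization of the scramble.

Let `η` be the mean over `Aᶜ` of the squared error, divided by `δ`; since the conditional mean is
`μ`, this is the first term of the claim. Markov's inequality on `Aᶜ`, plus `P A ≤ δ`, shows that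
one copy has squared error above `η` with probability at most `2δ`. The values with squared error at
most `η` form an interval, so the median leaves it only if some `r` of the `2r - 1` copies do. A
union bound over fewer than `4 ^ r` index sets and independence give probability at most `(8δ) ^ r`,
and there the squared error is at most `Δ ^ 2` (`lintegral_sampleMedian_sq_le`).

For the bound by `Δ`, the oscillation is immediate. For the variation, a unit lower triangular
matrix and a shift merely relabel digit prefixes, so scrambled points keep the net property at the
level of digits (`IsDigitalNet.digitNet_scrambled`). Induction on the number of controlled digits
bounds the local discrepancy, with Pascal's rule producing the binomial sum
(`DigitNet.discrepancy_le`). A discrete Koksma–Hlawka inequality for signed point masses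
(`ofReal_abs_sum_mul_le`), applied to the net against a fine stratified sample whose averaged mean
is exactly the integral, turns discrepancy into error without any regularity of `f` beyond
integrability and finite variation. -/

namespace MedianQMC

/-! ### Medians of independent samples -/

/-- If the sample median is outside an interval, then so are at least `r` of the samples. -/
lemma le_card_of_sampleMedian_notMem {r : ℕ} (hr : 0 < r) (x : Fin (2 * r - 1) → ℝ) {G : Set ℝ}
    (hG : G.OrdConnected) (hx : sampleMedian hr x ∉ G) :
    ∃ T : Finset (Fin (2 * r - 1)), T.card = r ∧ ∀ k ∈ T, x k ∉ G := by
  have hmono : Monotone (x ∘ Tuple.sort x) := Tuple.monotone_sort x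
  set p : Fin (2 * r - 1) := ⟨r - 1, by omega⟩ with hp
  by_contra! hT
  -- The `r` sorted positions up to the middle one and the `r` from the middle one on each contain a
  -- good sample; the median lies between these two, hence in the interval `G`.
  have key : ∀ S : Finset (Fin (2 * r - 1)), S.card = r → ∃ k ∈ S, x (Tuple.sort x k) ∈ G := by
    intro S hS
    obtain ⟨k, hk, hkG⟩ := hT (S.map (Tuple.sort x).toEmbedding) (by simpa using hS)
    obtain ⟨q, hq, rfl⟩ := Finset.mem_map.1 hk
    exact ⟨q, hq, hkG⟩
  obtain ⟨a, ha, haG⟩ := key (Finset.Iic p) (by rw [Fin.card_Iic]; simp [hp]; omega)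
  obtain ⟨b, hb, hbG⟩ := key (Finset.Ici p) (by rw [Fin.card_Ici]; simp [hp]; omega)
  exact hx (hG.out haG hbG ⟨hmono (Finset.mem_Iic.1 ha), hmono (Finset.mem_Ici.1 hb)⟩)

/-- Squared distance to `c` is monotone on either side of `c`. This makes the set of acceptable
errors an interval, as the median argument requires. -/
lemma ordConnected_ofReal_sq_le (c : ℝ) (η : ℝ≥0∞) :
    {y : ℝ | ENNReal.ofReal ((y - c) ^ 2) ≤ η}.OrdConnected := by
  refine ⟨fun a ha b hb y hy => ?_⟩
  simp only [Set.mem_ofPred_eq] at *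
  rcases le_total c y with h | h
  · exact (ENNReal.ofReal_le_ofReal (by nlinarith [hy.1, hy.2])).trans hb
  · exact (ENNReal.ofReal_le_ofReal (by nlinarith [hy.1, hy.2])).trans ha

lemma measurableSet_ofReal_sq_le (c : ℝ) (η : ℝ≥0∞) :
    MeasurableSet {y : ℝ | ENNReal.ofReal ((y - c) ^ 2) ≤ η} :=
  measurableSet_le (by fun_prop) measurable_const

/-- The sample median is bad only if `r` independent samples are bad. -/
lemma measure_sampleMedian_notMem_le {r : ℕ} (hr : 0 < r) {Ω : Type*} [MeasurableSpace Ω]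
    (P : Measure Ω) (X : Fin (2 * r - 1) → Ω → ℝ) (hX : iIndepFun X P) {G : Set ℝ}
    (hG : G.OrdConnected) (hGm : MeasurableSet G) {p : ℝ≥0∞}
    (hp : ∀ k, P (X k ⁻¹' Gᶜ) ≤ p) :
    P {ω | sampleMedian hr (fun k => X k ω) ∉ G} ≤ (4 * p) ^ r := by
  have hsub : {ω | sampleMedian hr (fun k => X k ω) ∉ G} ⊆
      ⋃ T ∈ Finset.powersetCard r (Finset.univ : Finset (Fin (2 * r - 1))),
        ⋂ k ∈ T, X k ⁻¹' Gᶜ := by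
    intro ω hω
    obtain ⟨T, hT, h⟩ := le_card_of_sampleMedian_notMem hr _ hG hω
    simp only [Set.mem_iUnion, Set.mem_iInter]
    exact ⟨T, by simp [hT], fun k hk => h k hk⟩
  calc P {ω | sampleMedian hr (fun k => X k ω) ∉ G}
      ≤ ∑ T ∈ Finset.powersetCard r (Finset.univ : Finset (Fin (2 * r - 1))),
          P (⋂ k ∈ T, X k ⁻¹' Gᶜ) := (measure_mono hsub).trans (measure_biUnion_finset_le _ _)
    _ ≤ ∑ T ∈ Finset.powersetCard r (Finset.univ : Finset (Fin (2 * r - 1))), p ^ r := by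
        refine Finset.sum_le_sum fun T hT => ?_
        rw [hX.measure_inter_preimage_eq_mul T (fun k _ => hGm.compl)]
        calc ∏ k ∈ T, P (X k ⁻¹' Gᶜ) ≤ ∏ _k ∈ T, p := Finset.prod_le_prod' fun k _ => hp k
          _ = p ^ r := by rw [Finset.prod_const, (Finset.mem_powersetCard.1 hT).2]
    _ = ((2 * r - 1).choose r : ℝ≥0∞) * p ^ r := by simp
    _ ≤ (4 * p) ^ r := by
        rw [mul_pow]
        gcongr
        have h : (2 * r - 1).choose r ≤ 4 ^ r := by
          refine (Nat.choose_le_two_pow _ _).trans ?_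
          rw [show (4 : ℕ) = 2 ^ 2 by norm_num, ← pow_mul]
          exact Nat.pow_le_pow_right (by norm_num) (by omega)
        exact_mod_cast h

/-- The factor `P E` cancels the normalization of the conditional measure, and `hc` lets the
variance be centred at `c`. -/
lemma measure_mul_evariance_cond {Ω : Type*} [MeasurableSpace Ω] (P : Measure Ω)
    [IsProbabilityMeasure P] (Y : Ω → ℝ) {E : Set Ω} (hE0 : P E ≠ 0) {c : ℝ}
    (hc : ∫ ω, Y ω ∂P[|E] = c) :
    P E * evariance Y P[|E] = ∫⁻ ω in E, ENNReal.ofReal ((Y ω - c) ^ 2) ∂P := by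
  rw [evariance, hc, ProbabilityTheory.cond, lintegral_smul_measure, smul_eq_mul, ← mul_assoc,
    ENNReal.mul_inv_cancel hE0 (measure_ne_top P E), one_mul]
  refine lintegral_congr fun ω => ?_
  rw [← ofReal_norm, ← ENNReal.ofReal_pow (norm_nonneg _), Real.norm_eq_abs, sq_abs]

/-- Outside an event of probability at most `δ`, use Chebyshev's inequality. -/
lemma measure_deviation_le {Ω : Type*} [MeasurableSpace Ω] (P : Measure Ω)
    [IsProbabilityMeasure P] (Y : Ω → ℝ) (hY : AEMeasurable Y P) {A : Set Ω}
    (hA : MeasurableSet A) (c : ℝ) {δ η : ℝ≥0∞} (hAδ : P A ≤ δ)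
    (hη : ∫⁻ ω in Aᶜ, ENNReal.ofReal ((Y ω - c) ^ 2) ∂P = η * δ) (hηtop : η ≠ ∞) :
    P (Y ⁻¹' {y : ℝ | ENNReal.ofReal ((y - c) ^ 2) ≤ η}ᶜ) ≤ 2 * δ := by
  have hm : AEMeasurable (fun ω => ENNReal.ofReal ((Y ω - c) ^ 2)) (P.restrict Aᶜ) := by
    have := hY.restrict (s := Aᶜ)
    fun_prop
  set B := Y ⁻¹' {y : ℝ | ENNReal.ofReal ((y - c) ^ 2) ≤ η}ᶜ with hB
  have h2 : P.restrict Aᶜ B ≤ δ := by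
    -- Markov's inequality divides by `η`; when `η = 0` the integrand vanishes almost everywhere on
    -- `Aᶜ` instead.
    rcases eq_or_ne η 0 with h0 | h0
    · rw [h0, zero_mul, lintegral_eq_zero_iff' hm] at hη
      have : P.restrict Aᶜ B = 0 := by
        refine measure_mono_null (fun ω hω => ?_) (ae_iff.1 hη)
        simpa [hB, h0] using hω
      simp [this]
    · have h := mul_meas_ge_le_lintegral₀ hm η
      rw [hη] at h
      refine (measure_mono fun ω hω => ?_).trans ((ENNReal.mul_le_mul_iff_right h0 hηtop).1 h)
      have hω' : ¬ ENNReal.ofReal ((Y ω - c) ^ 2) ≤ η := hω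
      exact (not_le.1 hω').le
  calc P B ≤ P (A ∪ B ∩ Aᶜ) := measure_mono fun ω hω => by
        by_cases h : ω ∈ A
        · exact Or.inl h
        · exact Or.inr ⟨hω, h⟩
    _ ≤ P A + P (B ∩ Aᶜ) := measure_union_le _ _
    _ ≤ δ + δ := by
        rw [Measure.restrict_apply' hA.compl] at h2
        exact add_le_add hAδ h2
    _ = 2 * δ := (two_mul δ).symm

/-- Mean squared error of the median of independent copies of `Y`, if `Y` deviates from `c` by at
most `Δ`. -/
theorem lintegral_sampleMedian_sq_le {r : ℕ} (hr : 0 < r)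
    {Ω : Type*} [MeasurableSpace Ω] (P : Measure Ω) [IsProbabilityMeasure P]
    (Y : Ω → ℝ) {A : Set Ω} (hA : MeasurableSet A) (hA0 : P Aᶜ ≠ 0)
    {δ : ℝ≥0∞} (hδ0 : δ ≠ 0) (hδ : δ ≠ ∞) (hAδ : P A ≤ δ) {c : ℝ}
    (hc : ∫ ω, Y ω ∂P[|Aᶜ] = c) {Δ : ℝ≥0∞} (hΔ : ∀ ω, ENNReal.ofReal |Y ω - c| ≤ Δ)
    {Ω' : Type*} [MeasurableSpace Ω'] (P' : Measure Ω') [IsProbabilityMeasure P']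
    (X : Fin (2 * r - 1) → Ω' → ℝ) (hXindep : iIndepFun X P')
    (hXlaw : ∀ k, IdentDistrib (X k) Y P' P) :
    ∫⁻ ω, ENNReal.ofReal ((sampleMedian hr (fun k => X k ω) - c) ^ 2) ∂P'
      ≤ P Aᶜ * evariance Y P[|Aᶜ] / δ + (8 * δ) ^ r * Δ ^ 2 := by
  rw [measure_mul_evariance_cond P Y hA0 hc]
  set η := (∫⁻ ω in Aᶜ, ENNReal.ofReal ((Y ω - c) ^ 2) ∂P) / δ with hη
  rcases eq_or_ne η ∞ with htop | htop
  · simp [htop]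
  have hη' : ∫⁻ ω in Aᶜ, ENNReal.ofReal ((Y ω - c) ^ 2) ∂P = η * δ :=
    (ENNReal.div_mul_cancel hδ0 hδ).symm
  have hY : AEMeasurable Y P := (hXlaw ⟨0, by omega⟩).aemeasurable_snd
  set G := {y : ℝ | ENNReal.ofReal ((y - c) ^ 2) ≤ η} with hGdef
  have hGm : MeasurableSet G := measurableSet_ofReal_sq_le c η
  have hbad : P' {ω | sampleMedian hr (fun k => X k ω) ∉ G} ≤ (8 * δ) ^ r := by
    have := measure_sampleMedian_notMem_le hr P' X hXindep (ordConnected_ofReal_sq_le c η) hGm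
      (p := 2 * δ) fun k => by
        rw [(hXlaw k).measure_mem_eq hGm.compl]
        exact measure_deviation_le P Y hY hA c hAδ hη' htop
    rwa [← mul_assoc, show (4 : ℝ≥0∞) * 2 = 8 by norm_num] at this
  have hsq : ∀ y : ℝ, ENNReal.ofReal |y - c| ^ 2 = ENNReal.ofReal ((y - c) ^ 2) := fun y => by
    rw [← ENNReal.ofReal_pow (abs_nonneg _), sq_abs]
  -- The bound `hΔ` concerns `Y`; equality of laws carries it to the copies, but only almost surely.
  -- The median is one of the copies, so it inherits the bound.
  have hall : ∀ᵐ ω ∂P', ∀ k, ENNReal.ofReal ((X k ω - c) ^ 2) ≤ Δ ^ 2 := by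
    rw [ae_all_iff]
    intro k
    have h := (hXlaw k).measure_mem_eq (measurableSet_ofReal_sq_le c (Δ ^ 2)).compl
    rw [ae_iff]
    refine h.trans ?_
    convert measure_empty (μ := P)
    ext ω
    simp only [Set.mem_preimage, Set.mem_compl_iff, Set.mem_ofPred_eq, Set.mem_empty_iff_false,
      iff_false, not_not]
    rw [← hsq]
    gcongr
    exact hΔ ω
  calc ∫⁻ ω, ENNReal.ofReal ((sampleMedian hr (fun k => X k ω) - c) ^ 2) ∂P'
      ≤ ∫⁻ ω, (η + {ω | sampleMedian hr (fun k => X k ω) ∉ G}.indicator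
          (fun _ => Δ ^ 2) ω) ∂P' := by
        refine lintegral_mono_ae ?_
        filter_upwards [hall] with ω hω
        by_cases h : sampleMedian hr (fun k => X k ω) ∈ G
        · exact le_add_right h
        · rw [Set.indicator_of_mem (by exact h)]
          exact le_add_left (hω _)
    _ = η + ∫⁻ ω, {ω | sampleMedian hr (fun k => X k ω) ∉ G}.indicator
          (fun _ => Δ ^ 2) ω ∂P' := by
        rw [lintegral_add_left measurable_const]; simp
    _ ≤ η + (8 * δ) ^ r * Δ ^ 2 := by
        gcongr
        refine (lintegral_indicator_const_le _ _).trans ?_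
        rw [mul_comm]
        gcongr

/-! ### Binary expansions -/

/-- The real number with binary digits `e 0, e 1, …`. -/
noncomputable def digitValue (e : ℕ → ZMod 2) : ℝ := ∑' l : ℕ, ((e l).val : ℝ) / 2 ^ (l + 1)

lemma val_le_one (a : ZMod 2) : a.val ≤ 1 := Nat.le_of_lt_succ (ZMod.val_lt a)

lemma hasSum_half_pow : HasSum (fun l : ℕ => (1 : ℝ) / 2 ^ (l + 1)) 1 := by
  have h := hasSum_geometric_two' 1
  simpa [div_eq_mul_inv, pow_succ, mul_comm] using h

lemma digit_div_le (e : ℕ → ZMod 2) (l : ℕ) :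
    ((e l).val : ℝ) / 2 ^ (l + 1) ≤ 1 / 2 ^ (l + 1) := by
  gcongr
  exact_mod_cast val_le_one (e l)

lemma summable_digits (e : ℕ → ZMod 2) :
    Summable fun l : ℕ => ((e l).val : ℝ) / 2 ^ (l + 1) :=
  Summable.of_nonneg_of_le (fun _ => by positivity) (digit_div_le e) hasSum_half_pow.summable

lemma digitValue_nonneg (e : ℕ → ZMod 2) : 0 ≤ digitValue e :=
  tsum_nonneg fun _ => by positivity

lemma digitValue_le_one (e : ℕ → ZMod 2) : digitValue e ≤ 1 := by
  rw [← hasSum_half_pow.tsum_eq]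
  exact (summable_digits e).tsum_le_tsum (digit_div_le e) hasSum_half_pow.summable

lemma digitValue_eq (e : ℕ → ZMod 2) :
    digitValue e = ((e 0).val + digitValue (fun l => e (l + 1))) / 2 := by
  rw [digitValue, (summable_digits e).tsum_eq_zero_add, digitValue, add_div, ← tsum_div_const]
  simp [div_div, pow_succ]

/-- Only the all-ones expansion reaches `1`; a single zero digit excludes it. -/
lemma digitValue_lt_one {e : ℕ → ZMod 2} {l : ℕ} (hl : e l = 0) : digitValue e < 1 := by
  induction l generalizing e with
  | zero =>
    have := digitValue_le_one (fun l => e (l + 1))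
    rw [digitValue_eq, hl, ZMod.val_zero]
    norm_num
    linarith
  | succ l ih =>
    have h := ih (e := fun l => e (l + 1)) hl
    have h0 : ((e 0).val : ℝ) ≤ 1 := by exact_mod_cast val_le_one (e 0)
    rw [digitValue_eq]
    linarith

/-- The number formed by the first `k` binary digits. -/
def digitPrefix (e : ℕ → ZMod 2) : ℕ → ℕ
  | 0 => 0
  | k + 1 => 2 * digitPrefix e k + (e k).val

lemma digitPrefix_lt (e : ℕ → ZMod 2) (k : ℕ) : digitPrefix e k < 2 ^ k := by
  induction k with
  | zero => simp [digitPrefix]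
  | succ k ih =>
    have := val_le_one (e k)
    rw [digitPrefix, pow_succ]
    omega

lemma digitPrefix_eq_iff (e e' : ℕ → ZMod 2) (k : ℕ) :
    digitPrefix e k = digitPrefix e' k ↔ ∀ l < k, e l = e' l := by
  induction k with
  | zero => simp [digitPrefix]
  | succ k ih =>
    have h1 := val_le_one (e k)
    have h2 := val_le_one (e' k)
    rw [Nat.forall_lt_succ_right, ← ih, digitPrefix, digitPrefix, ← (ZMod.val_injective 2).eq_iff]
    omega

lemma digitValue_eq_digitPrefix_add (e : ℕ → ZMod 2) (k : ℕ) :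
    digitValue e = (digitPrefix e k + digitValue (fun l => e (k + l))) / 2 ^ k := by
  induction k with
  | zero => simp [digitPrefix]
  | succ k ih =>
    rw [ih, digitValue_eq (fun l => e (k + l)), digitPrefix]
    push_cast
    simp only [add_zero, add_assoc, add_comm 1]
    field_simp
    ring

/-! ### Nets in terms of digits -/

/-- For all prefix lengths `k j` adding up to `d`, exactly `2 ^ t` of the digit vectors `X i`,
`i ∈ I`, have prescribed first `k j` digits in each coordinate `j`. -/
def DigitNet {ι : Type*} {s : ℕ} (d t : ℕ) (I : Finset ι) (X : ι → Fin s → ℕ → ZMod 2) : Prop :=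
  ∀ (k : Fin s → ℕ) (e : Fin s → ℕ → ZMod 2), ∑ j, k j = d →
    (I.filter fun i => ∀ j, ∀ l < k j, X i j l = e j l).card = 2 ^ t

/-- Drop the first digit in the coordinate `j₀`. -/
def dropDigit {s : ℕ} (j₀ : Fin s) (x : Fin s → ℕ → ZMod 2) : Fin s → ℕ → ZMod 2 :=
  Function.update x j₀ fun l => x j₀ (l + 1)

/-- Self-similarity of nets: the points in one half of the cube, stretched back to the full cube,
form a net with one controlled digit fewer. This drives the inductions on `d`. -/
lemma DigitNet.filter_digit {ι : Type*} {s d t : ℕ} {I : Finset ι} {X : ι → Fin s → ℕ → ZMod 2}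
    (h : DigitNet (d + 1) t I X) (j₀ : Fin s) (b : ZMod 2) :
    DigitNet d t (I.filter fun i => X i j₀ 0 = b) (fun i => dropDigit j₀ (X i)) := by
  intro k e hk
  -- In coordinate `j₀` the prescribed prefix is `b` followed by `e j₀`, hence one digit longer.
  rw [← h (Function.update k j₀ (k j₀ + 1))
    (Function.update e j₀ fun l => Nat.casesOn l b (e j₀)) ?_, Finset.filter_filter]
  · congr 1
    refine Finset.filter_congr fun i _ => ?_
    constructor
    · rintro ⟨h0, h1⟩ j l hl
      by_cases hj : j = j₀
      · subst hj
        rw [Function.update_self] at hl ⊢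
        cases l with
        | zero => exact h0
        | succ l => simpa [dropDigit] using h1 j l (by omega)
      · rw [Function.update_of_ne hj] at hl ⊢
        simpa [dropDigit, hj] using h1 j l hl
    · intro h1
      refine ⟨by simpa using h1 j₀ 0 (by simp), fun j l hl => ?_⟩
      by_cases hj : j = j₀
      · subst hj
        simpa [dropDigit] using h1 j (l + 1) (by simpa using hl)
      · simpa [dropDigit, hj] using h1 j l (by simpa [hj] using hl)
  · rw [Finset.sum_update_of_mem (Finset.mem_univ _), ← hk,
      ← Finset.add_sum_erase _ _ (Finset.mem_univ j₀), Finset.sdiff_singleton_eq_erase]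
    ring

lemma zmod_two_eq_one_of_ne_zero {a : ZMod 2} (h : a ≠ 0) : a = 1 := by
  revert a
  decide

lemma card_filter_digit {ι : Type*} (I : Finset ι) (Y : ι → ZMod 2) (p : ι → Prop)
    [DecidablePred p] :
    (I.filter p).card
      = ((I.filter fun i => Y i = 0).filter p).card
        + ((I.filter fun i => Y i = 1).filter p).card := by
  rw [← Finset.card_filter_add_card_filter_not (s := I.filter p) (fun i => Y i = 0),
    Finset.filter_comm, Finset.filter_comm (fun i => Y i = 1)]
  congr 2
  refine Finset.filter_congr fun i _ => ⟨zmod_two_eq_one_of_ne_zero, fun h => ?_⟩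
  rw [h]
  decide

/-- Some coordinate is needed to spend digits on: for `s = 0` and `d > 0` the net condition is
vacuous. -/
lemma DigitNet.card_eq {ι : Type*} {s d t : ℕ} [NeZero s] {I : Finset ι}
    {X : ι → Fin s → ℕ → ZMod 2} (h : DigitNet d t I X) : I.card = 2 ^ (d + t) := by
  induction d generalizing I X with
  | zero => simpa using h (fun _ => 0) (fun _ _ => 0) (by simp)
  | succ d ih =>
    have := card_filter_digit I (fun i => X i 0 0) (fun _ => True)
    simp only [Finset.filter_true] at this
    rw [this, ih (h.filter_digit 0 0), ih (h.filter_digit 0 1)]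
    ring

/-- Local discrepancy of a net at a point with irrational coordinates. -/
theorem DigitNet.discrepancy_le {ι : Type*} {s d t : ℕ} [NeZero s] {I : Finset ι}
    {X : ι → Fin s → ℕ → ZMod 2} (h : DigitNet d t I X) (u : Finset (Fin s)) (z : Fin s → ℝ)
    (hz : ∀ j ∈ u, z j ∈ Set.Ioo (0 : ℝ) 1 ∧ Irrational (z j)) :
    |((I.filter fun i => ∀ j ∈ u, digitValue (X i j) < z j).card : ℝ)
        - 2 ^ (d + t) * ∏ j ∈ u, z j|
      ≤ 2 ^ t * ∑ i ∈ Finset.range u.card, (d.choose i : ℝ) := by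
  induction d generalizing I X u z with
  | zero =>
    rcases u.eq_empty_or_nonempty with rfl | hu
    · simp [h.card_eq]
    -- Without controlled digits the trivial estimate suffices: the count and the scaled volume both
    -- lie in `[0, 2 ^ t]`, and the binomial sum is at least `1` for nonempty `u`.
    have h1 : ((I.filter fun i => ∀ j ∈ u, digitValue (X i j) < z j).card : ℝ) ≤ 2 ^ t := by
      have := Finset.card_filter_le I fun i => ∀ j ∈ u, digitValue (X i j) < z j
      rw [h.card_eq, zero_add] at this
      exact_mod_cast this
    have h2 : 0 ≤ ∏ j ∈ u, z j := Finset.prod_nonneg fun j hj => (hz j hj).1.1.le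
    have h3 : ∏ j ∈ u, z j ≤ 1 :=
      Finset.prod_le_one (fun j hj => (hz j hj).1.1.le) fun j hj => (hz j hj).1.2.le
    have h4 : (1 : ℝ) ≤ ∑ i ∈ Finset.range u.card, (Nat.choose 0 i : ℝ) := by
      have := Finset.single_le_sum (f := fun i => (Nat.choose 0 i : ℝ)) (fun _ _ => by positivity)
        (Finset.mem_range.2 hu.card_pos)
      simpa using this
    have ht : (0 : ℝ) < 2 ^ t := by positivity
    rw [zero_add, abs_le]
    have h5 : (0 : ℝ) ≤ (I.filter fun i => ∀ j ∈ u, digitValue (X i j) < z j).card := by positivity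
    constructor <;> nlinarith
  | succ d ih =>
    rcases u.eq_empty_or_nonempty with rfl | ⟨j₀, hj₀⟩
    · simp [h.card_eq]
    obtain ⟨⟨hz0, hz1⟩, hirr⟩ := hz j₀ hj₀
    have hv : ∀ i, digitValue (X i j₀)
        = ((X i j₀ 0).val + digitValue (dropDigit j₀ (X i) j₀)) / 2 := fun i => by
      rw [digitValue_eq]; simp [dropDigit]
    have hv0 : ∀ i, 0 ≤ digitValue (dropDigit j₀ (X i) j₀) := fun i => digitValue_nonneg _
    have hv1 : ∀ i, digitValue (dropDigit j₀ (X i) j₀) ≤ 1 := fun i => digitValue_le_one _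
    have hne : ∀ i, ∀ j ∈ u.erase j₀, dropDigit j₀ (X i) j = X i j := fun i j hj => by
      simp [dropDigit, Finset.ne_of_mem_erase hj]
    have hsplit : ∀ (p : Fin s → Prop), (∀ j ∈ u, p j) ↔ p j₀ ∧ ∀ j ∈ u.erase j₀, p j := by
      intro p
      conv_lhs => rw [← Finset.insert_erase hj₀]
      exact Finset.forall_mem_insert _ _ _
    have hprod : ∏ j ∈ u, z j = z j₀ * ∏ j ∈ u.erase j₀, z j :=
      (Finset.mul_prod_erase u z hj₀).symm
    have hupd : ∀ c : ℝ, ∏ j ∈ u, Function.update z j₀ c j = c * ∏ j ∈ u.erase j₀, z j := by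
      intro c
      rw [← Finset.mul_prod_erase u _ hj₀, Function.update_self]
      congr 1
      exact Finset.prod_congr rfl fun j hj => by
        rw [Function.update_of_ne (Finset.ne_of_mem_erase hj)]
    have hcond : ∀ c : ℝ, c ∈ Set.Ioo (0 : ℝ) 1 → Irrational c → ∀ j ∈ u,
        Function.update z j₀ c j ∈ Set.Ioo (0 : ℝ) 1 ∧ Irrational (Function.update z j₀ c j) := by
      intro c hc hc' j hj
      by_cases hjj : j = j₀
      · subst hjj; simpa using ⟨hc, hc'⟩
      · simpa [hjj] using hz j hj
    have hupdlt : ∀ (c : ℝ) i, (∀ j ∈ u, digitValue (dropDigit j₀ (X i) j)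
        < Function.update z j₀ c j) ↔ digitValue (dropDigit j₀ (X i) j₀) < c ∧
          ∀ j ∈ u.erase j₀, digitValue (X i j) < z j := by
      intro c i
      rw [hsplit, Function.update_self]
      refine and_congr_right fun _ => forall₂_congr fun j hj => ?_
      rw [hne i j hj, Function.update_of_ne (Finset.ne_of_mem_erase hj)]
    rw [card_filter_digit I (fun i => X i j₀ 0)]
    -- Irrationality excludes the tie at the midpoint and survives the maps `z ↦ 2z` and `z ↦ 2z -
    -- 1`.
    have hhalf : z j₀ ≠ 1 / 2 := by
      have := hirr.ne_rat (1 / 2)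
      push_cast at this
      exact this
    rcases lt_or_gt_of_ne hhalf with hlt | hgt
    -- The box lies in the lower half: points with first digit `1` drop out, and stretching the
    -- others doubles `z j₀`.
    · have hirr' : Irrational (2 * z j₀) := by
        have := hirr.natCast_mul (m := 2) (by norm_num)
        exact_mod_cast this
      have key := ih (h.filter_digit j₀ 0) u (Function.update z j₀ (2 * z j₀))
        (hcond _ ⟨by linarith, by linarith⟩ hirr')
      have e0 : ((I.filter fun i => X i j₀ 0 = 0).filter
            fun i => ∀ j ∈ u, digitValue (X i j) < z j)
          = (I.filter fun i => X i j₀ 0 = 0).filter fun i => ∀ j ∈ u,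
              digitValue (dropDigit j₀ (X i) j) < Function.update z j₀ (2 * z j₀) j := by
        refine Finset.filter_congr fun i hi => ?_
        rw [hupdlt, hsplit, hv, (Finset.mem_filter.1 hi).2, ZMod.val_zero]
        refine and_congr_left fun _ => ?_
        push_cast
        constructor <;> intro _ <;> linarith
      have e1 : ((I.filter fun i => X i j₀ 0 = 1).filter
            fun i => ∀ j ∈ u, digitValue (X i j) < z j) = ∅ := by
        refine Finset.filter_eq_empty_iff.2 fun i hi hlt' => ?_
        have h1 := hlt' j₀ hj₀
        rw [hv, (Finset.mem_filter.1 hi).2, ZMod.val_one] at h1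
        have := hv0 i
        push_cast at h1
        linarith
      rw [e0, e1, Finset.card_empty, add_zero, hprod]
      rw [hupd] at key
      calc _ = _ := by
            congr 2
            ring
        _ ≤ _ := key
        _ ≤ _ := by
            gcongr
            exact Nat.le_succ d
    -- The box contains the whole lower half in direction `j₀`, so there `j₀` leaves `u`; in the
    -- upper half the threshold becomes `2 * z j₀ - 1`. The two discrepancies add up.
    · have hirr' : Irrational (2 * z j₀ - 1) := by
        have := (hirr.natCast_mul (m := 2) (by norm_num)).sub_natCast 1
        exact_mod_cast this
      have key0 := ih (h.filter_digit j₀ 0) (u.erase j₀) z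
        (fun j hj => hz j (Finset.mem_of_mem_erase hj))
      have key1 := ih (h.filter_digit j₀ 1) u (Function.update z j₀ (2 * z j₀ - 1))
        (hcond _ ⟨by linarith, by linarith⟩ hirr')
      have e0 : ((I.filter fun i => X i j₀ 0 = 0).filter
            fun i => ∀ j ∈ u, digitValue (X i j) < z j)
          = (I.filter fun i => X i j₀ 0 = 0).filter fun i => ∀ j ∈ u.erase j₀,
              digitValue (dropDigit j₀ (X i) j) < z j := by
        refine Finset.filter_congr fun i hi => ?_
        rw [hsplit, hv, (Finset.mem_filter.1 hi).2, ZMod.val_zero, and_iff_right]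
        · exact forall₂_congr fun j hj => by rw [hne i j hj]
        · have := hv1 i
          push_cast
          linarith
      have e1 : ((I.filter fun i => X i j₀ 0 = 1).filter
            fun i => ∀ j ∈ u, digitValue (X i j) < z j)
          = (I.filter fun i => X i j₀ 0 = 1).filter fun i => ∀ j ∈ u,
              digitValue (dropDigit j₀ (X i) j) < Function.update z j₀ (2 * z j₀ - 1) j := by
        refine Finset.filter_congr fun i hi => ?_
        rw [hupdlt, hsplit, hv, (Finset.mem_filter.1 hi).2, ZMod.val_one]
        refine and_congr_left fun _ => ?_
        push_cast
        constructor <;> intro _ <;> linarith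
      rw [e0, e1, hprod]
      rw [hupd] at key1
      obtain ⟨c, hc⟩ : ∃ c, u.card = c + 1 := Nat.exists_eq_succ_of_ne_zero
        (Finset.card_ne_zero_of_mem hj₀)
      rw [Finset.card_erase_of_mem hj₀, hc, Nat.add_sub_cancel] at key0
      rw [hc] at key1 ⊢
      -- Pascal's rule: the two recursive bounds, with `c` and `c + 1` coordinates, sum exactly to
      -- the claimed one.
      have hsum : ∑ i ∈ Finset.range (c + 1), ((d + 1).choose i : ℝ)
          = ∑ i ∈ Finset.range c, (d.choose i : ℝ)
            + ∑ i ∈ Finset.range (c + 1), (d.choose i : ℝ) := by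
        rw [Finset.sum_range_succ', Finset.sum_range_succ' (fun i => (d.choose i : ℝ))]
        simp only [Nat.choose_succ_succ', Nat.cast_add, Finset.sum_add_distrib, Nat.choose_zero_right]
        ring
      rw [hsum, mul_add]
      refine le_trans (le_of_eq ?_) ((abs_add_le _ _).trans (add_le_add key0 key1))
      congr 1
      push_cast
      ring

/-! ### Scrambling preserves nets -/

/-- The binary digits of the points of a digital net, padded with zeros. -/
def netDigit {s m : ℕ} (C : Fin s → Matrix (Fin m) (Fin m) (ZMod 2))
    (i : Fin (2 ^ m)) (j : Fin s) (l : ℕ) : ZMod 2 :=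
  if h : l < m then (C j).mulVec (bits m i) ⟨l, h⟩ else 0

lemma digitalPoint_eq {s m : ℕ} (C : Fin s → Matrix (Fin m) (Fin m) (ZMod 2))
    (i : Fin (2 ^ m)) (j : Fin s) : digitalPoint C i j = digitValue (netDigit C i j) := by
  rw [digitValue, tsum_eq_sum (s := Finset.range m), Finset.sum_range]
  · refine Finset.sum_congr rfl fun l _ => ?_
    simp [netDigit]
  · intro l hl
    simp [netDigit, Finset.mem_range.not.1 hl]

/-- The terminating expansion matters: a tail of ones would put the value on the right endpoint of
its interval. -/
lemma mem_Ico_iff_digitPrefix {e : ℕ → ZMod 2} {m : ℕ} (he : ∀ l, m ≤ l → e l = 0) (k c : ℕ) :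
    digitValue e ∈ Set.Ico ((c : ℝ) / 2 ^ k) (((c : ℝ) + 1) / 2 ^ k) ↔ digitPrefix e k = c := by
  have h0 := digitValue_nonneg fun l => e (k + l)
  have h1 : digitValue (fun l => e (k + l)) < 1 := digitValue_lt_one (l := m) (he _ (by omega))
  have hk : (0 : ℝ) < 2 ^ k := by positivity
  rw [digitValue_eq_digitPrefix_add e k, Set.mem_Ico, div_le_div_iff_of_pos_right hk,
    div_lt_div_iff_of_pos_right hk]
  constructor
  · rintro ⟨h2, h3⟩
    have h4 : (c : ℝ) < digitPrefix e k + 1 := by linarith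
    have h5 : (digitPrefix e k : ℝ) < c + 1 := by linarith
    norm_cast at h4 h5
    omega
  · rintro rfl
    constructor <;> linarith

lemma IsDigitalNet.digitNet {s m t : ℕ} {C : Fin s → Matrix (Fin m) (Fin m) (ZMod 2)}
    (hC : IsDigitalNet t C) : DigitNet (m - t) t Finset.univ (netDigit C) := by
  intro k e hk
  have h := hC.card k (fun j => digitPrefix (e j) (k j)) hk fun j => digitPrefix_lt _ _
  rw [← h, ← Set.ncard_coe_finset]
  congr 1
  ext i
  simp only [Finset.coe_filter, Finset.mem_univ, true_and, Set.mem_ofPred_eq, Nat.cast_ofNat,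
    digitalPoint_eq]
  refine forall_congr' fun j => ?_
  rw [mem_Ico_iff_digitPrefix (m := m) (fun l hl => by simp [netDigit, hl]), digitPrefix_eq_iff]

/-- Solving a unit lower triangular system of congruences by forward substitution. -/
lemma exists_prefix_of_triangular (F : ℕ → (ℕ → ZMod 2) → ZMod 2)
    (hF : ∀ l v w, (∀ q < l, v q = w q) → F l v = F l w) (e : ℕ → ZMod 2) (k : ℕ) :
    ∃ e' : ℕ → ZMod 2, ∀ v : ℕ → ZMod 2,
      (∀ l < k, v l + F l v = e l) ↔ ∀ l < k, v l = e' l := by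
  induction k with
  | zero => exact ⟨e, by simp⟩
  | succ k ih =>
    obtain ⟨e', he'⟩ := ih
    refine ⟨Function.update e' k (e k - F k e'), fun v => ?_⟩
    have hup : (∀ l < k, v l = Function.update e' k (e k - F k e') l) ↔ ∀ l < k, v l = e' l :=
      forall₂_congr fun l hl => by rw [Function.update_of_ne hl.ne]
    rw [Nat.forall_lt_succ_right, Nat.forall_lt_succ_right, he', hup, Function.update_self]
    refine and_congr_right fun hv => ?_
    rw [hF k v e' hv, eq_sub_iff_add_eq]

/-- The binary digits of the scrambled points. -/
def scrambledDigit {s m : ℕ} (C : Fin s → Matrix (Fin m) (Fin m) (ZMod 2))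
    (M : Fin s → Matrix ℕ (Fin m) (ZMod 2)) (D : Fin s → ℕ → ZMod 2)
    (i : Fin (2 ^ m)) (j : Fin s) (l : ℕ) : ZMod 2 :=
  (M j * C j).mulVec (bits m i) l + D j l

lemma scrambledDigit_eq {s m : ℕ} (C : Fin s → Matrix (Fin m) (Fin m) (ZMod 2))
    (M : Fin s → Matrix ℕ (Fin m) (ZMod 2)) (D : Fin s → ℕ → ZMod 2)
    (hupper : ∀ j (l : ℕ) (k : Fin m), l < k → M j l k = 0) (hdiag : ∀ j (k : Fin m), M j k k = 1)
    (i : Fin (2 ^ m)) (j : Fin s) {l : ℕ} (hl : l < m) :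
    scrambledDigit C M D i j l = netDigit C i j l
      + ((∑ q : Fin m, if (q : ℕ) < l then M j l q * netDigit C i j q else 0) + D j l) := by
  rw [scrambledDigit, ← Matrix.mulVec_mulVec, ← add_assoc]
  congr 1
  have h1 : netDigit C i j l
      = ∑ q : Fin m, if q = ⟨l, hl⟩ then netDigit C i j q else 0 := by simp
  rw [h1, ← Finset.sum_add_distrib, Matrix.mulVec, dotProduct]
  refine Finset.sum_congr rfl fun q _ => ?_
  have h2 : netDigit C i j q = (C j).mulVec (bits m i) q := by simp [netDigit]
  rw [h2]
  rcases lt_trichotomy (q : ℕ) l with h | h | h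
  · simp [h, Fin.ext_iff, h.ne]
  · subst h
    simp [hdiag]
  · simp [hupper j l q h, Fin.ext_iff, h.ne', h.not_gt]

/-- Each scrambled digit is the net digit plus a function of earlier net digits. Forward
substitution thus turns a prescribed scrambled prefix into a prescribed net prefix of the same
length, and the counts agree. -/
lemma IsDigitalNet.digitNet_scrambled {s m t : ℕ} {C : Fin s → Matrix (Fin m) (Fin m) (ZMod 2)}
    (hC : IsDigitalNet t C) (M : Fin s → Matrix ℕ (Fin m) (ZMod 2)) (D : Fin s → ℕ → ZMod 2)
    (hupper : ∀ j (l : ℕ) (k : Fin m), l < k → M j l k = 0)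
    (hdiag : ∀ j (k : Fin m), M j k k = 1) :
    DigitNet (m - t) t Finset.univ (scrambledDigit C M D) := by
  intro k e hk
  -- Only the first `m` digits are prescribed, which is where the unit diagonal is available.
  have hkm : ∀ j, k j ≤ m := fun j =>
    (Finset.single_le_sum (fun _ _ => Nat.zero_le _) (Finset.mem_univ j)).trans
      (hk.le.trans (Nat.sub_le m t))
  choose e' he' using fun j => exists_prefix_of_triangular
    (fun l v => (∑ q : Fin m, if (q : ℕ) < l then M j l q * v q else 0) + D j l)
    (fun l v w hvw => by
      congr 1
      refine Finset.sum_congr rfl fun q _ => ?_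
      split_ifs with hq
      · rw [hvw q hq]
      · rfl) (e j) (k j)
  rw [← hC.digitNet k e' hk]
  congr 1
  refine Finset.filter_congr fun i _ => forall_congr' fun j => ?_
  rw [← he']
  exact forall₂_congr fun l hl => by
    rw [scrambledDigit_eq C M D hupper hdiag i j (hl.trans_le (hkm j))]

/-! ### The Koksma–Hlawka inequality for finitely many weighted points -/

lemma increment_prod {s : ℕ} (h : Fin s → ℝ → ℝ) (u : Finset (Fin s)) (a b : Fin s → ℝ) :
    increment (fun x => ∏ j, h j (x j)) u a b
      = (∏ j ∈ u, (h j (b j) - h j (a j))) * ∏ j ∈ uᶜ, h j 1 := by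
  simp only [sub_eq_add_neg]
  rw [Finset.prod_add, Finset.sum_mul, increment]
  refine Finset.sum_congr rfl fun v hv => ?_
  have hvu := Finset.mem_powerset.1 hv
  rw [Finset.prod_neg, ← Finset.prod_mul_prod_compl u, ← Finset.prod_sdiff hvu]
  have h1 : ∏ j ∈ u \ v, h j (if j ∈ v then b j else if j ∈ u then a j else 1)
      = ∏ j ∈ u \ v, h j (a j) := Finset.prod_congr rfl fun j hj => by
    rw [Finset.mem_sdiff] at hj
    simp [hj.1, hj.2]
  have h2 : ∏ j ∈ v, h j (if j ∈ v then b j else if j ∈ u then a j else 1)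
      = ∏ j ∈ v, h j (b j) := Finset.prod_congr rfl fun j hj => by simp [hj]
  have h3 : ∏ j ∈ uᶜ, h j (if j ∈ v then b j else if j ∈ u then a j else 1)
      = ∏ j ∈ uᶜ, h j 1 := Finset.prod_congr rfl fun j hj => by
    rw [Finset.mem_compl] at hj
    have hjv : j ∉ v := fun h => hj (hvu h)
    simp [hj, hjv]
  rw [h1, h2, h3]
  ring

lemma increment_sum {s : ℕ} {κ : Type*} (T : Finset κ) (c : κ → ℝ) (F : κ → (Fin s → ℝ) → ℝ)
    (u : Finset (Fin s)) (a b : Fin s → ℝ) :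
    increment (fun x => ∑ p ∈ T, c p * F p x) u a b = ∑ p ∈ T, c p * increment (F p) u a b := by
  simp only [increment, Finset.mul_sum]
  rw [Finset.sum_comm]
  refine Finset.sum_congr rfl fun p _ => Finset.sum_congr rfl fun v _ => ?_
  ring

lemma prod_sum_eq_sum_piFinset {s : ℕ} (u : Finset (Fin s)) (N : ℕ) (F : Fin s → ℕ → ℝ) :
    ∏ j ∈ u, ∑ k ∈ Finset.range N, F j k
      = ∑ i ∈ Fintype.piFinset (fun j => if j ∈ u then Finset.range N else {0}),
          ∏ j ∈ u, F j (i j) := by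
  have h : ∀ i : Fin s → ℕ, ∏ j ∈ u, F j (i j) = ∏ j, if j ∈ u then F j (i j) else 1 := by
    intro i
    rw [Finset.prod_ite_mem, Finset.univ_inter]
  simp only [h]
  rw [← Finset.prod_univ_sum _ (fun j k => if j ∈ u then F j k else 1),
    ← Finset.univ_inter u, ← Finset.prod_ite_mem]
  refine Finset.prod_congr rfl fun j _ => ?_
  by_cases hj : j ∈ u <;> simp [hj]

/-- Telescoping down from the anchor `g N`. The range of summation is encoded as a 0-1 weight so
that multiplying over coordinates yields indicators of boxes. -/
lemma telescope_above (h : ℝ → ℝ) {g : ℕ → ℝ} {N a : ℕ} (hg : StrictMonoOn g (Set.Iic N))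
    (ha : a ≤ N) :
    h (g a) = h (g N) + -∑ k ∈ Finset.range N,
      (if g a ≤ g k then 1 else 0) * (h (g (k + 1)) - h (g k)) := by
  have h1 : ∑ k ∈ Finset.range N, (if g a ≤ g k then (1 : ℝ) else 0) * (h (g (k + 1)) - h (g k))
      = ∑ k ∈ Finset.Ico a N, (h (g (k + 1)) - h (g k)) := by
    have : Finset.Ico a N = (Finset.range N).filter fun k => a ≤ k := by
      ext k
      simp [and_comm]
    rw [this, Finset.sum_filter]
    refine Finset.sum_congr rfl fun k hk => ?_
    have hk' : k ≤ N := (Finset.mem_range.1 hk).le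
    simp only [hg.le_iff_le (Set.mem_Iic.2 ha) (Set.mem_Iic.2 hk')]
    split_ifs <;> simp
  rw [h1, Finset.sum_Ico_sub (fun k => h (g k)) ha]
  ring

/-- Expansion of a function at a grid point into its increments over the grid cells. -/
lemma eq_sum_increment {s : ℕ} (f : (Fin s → ℝ) → ℝ) {g : ℕ → ℝ} {N : ℕ}
    (hg : StrictMonoOn g (Set.Iic N)) (hN : g N = 1) (x : Fin s → ℝ)
    (hx : ∀ j, ∃ a ≤ N, g a = x j) :
    f x = ∑ u : Finset (Fin s), (-1) ^ u.card *
      ∑ i ∈ Fintype.piFinset (fun j => if j ∈ u then Finset.range N else {0}),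
        (if ∀ j ∈ u, x j ≤ g (i j) then 1 else 0) *
          increment f u (fun j => g (i j)) (fun j => g (i j + 1)) := by
  -- For product functions the expansion is the product of the one-dimensional telescoping sums,
  -- multiplied out over subsets `u`.
  have hprod : ∀ h : Fin s → ℝ → ℝ, ∏ j, h j (x j) = ∑ u : Finset (Fin s), (-1) ^ u.card *
      ∑ i ∈ Fintype.piFinset (fun j => if j ∈ u then Finset.range N else {0}),
        (if ∀ j ∈ u, x j ≤ g (i j) then 1 else 0) *
          increment (fun x => ∏ j, h j (x j)) u (fun j => g (i j)) (fun j => g (i j + 1)) := by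
    intro h
    choose a haN hax using hx
    have h1 : ∀ j, h j (x j) = -(∑ k ∈ Finset.range N,
        (if x j ≤ g k then 1 else 0) * (h j (g (k + 1)) - h j (g k))) + h j 1 := fun j => by
      have := telescope_above (h j) hg (haN j)
      rw [hax, hN] at this
      rw [this, add_comm]
    rw [Finset.prod_congr rfl fun j _ => h1 j, Finset.prod_add, Finset.powerset_univ]
    refine Finset.sum_congr rfl fun u _ => ?_
    rw [Finset.prod_neg, prod_sum_eq_sum_piFinset, mul_assoc, Finset.sum_mul]
    congr 1
    refine Finset.sum_congr rfl fun i _ => ?_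
    rw [increment_prod, Finset.prod_mul_distrib, Finset.prod_boole, mul_assoc,
      ← Finset.compl_eq_univ_sdiff]
    congr!
  classical
  set S : Finset ℝ := (Finset.range (N + 1)).image g with hS
  have hgS : ∀ k ≤ N, g k ∈ S := fun k hk =>
    Finset.mem_image_of_mem g (Finset.mem_range.2 (by omega))
  -- Only values at grid points occur, and there `f` agrees with this linear combination of products
  -- of point indicators; linearity reduces to `hprod`.
  set f' : (Fin s → ℝ) → ℝ := fun x => ∑ p ∈ Fintype.piFinset (fun _ => S),
    f p * ∏ j, (if x j = p j then 1 else 0) with hf'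
  have hff' : ∀ x : Fin s → ℝ, (∀ j, x j ∈ (S : Set ℝ)) → f x = f' x := by
    intro x hx
    have hmem : x ∈ Fintype.piFinset (fun _ => S) := Fintype.mem_piFinset.2 hx
    have h1 : ∀ p : Fin s → ℝ, (∏ j, if x j = p j then (1 : ℝ) else 0)
        = if x = p then 1 else 0 := fun p => by
      rw [Finset.prod_boole]
      simp [funext_iff]
    simp only [hf', h1, mul_ite, mul_one, mul_zero]
    rw [Finset.sum_ite_eq, if_pos hmem]
  have hxS : ∀ j, x j ∈ (S : Set ℝ) := fun j => by
    obtain ⟨a, ha, hax⟩ := hx j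
    exact hax ▸ hgS a ha
  have hinc : ∀ u, ∀ i ∈ Fintype.piFinset (fun j => if j ∈ u then Finset.range N else {0}),
      increment f u (fun j => g (i j)) (fun j => g (i j + 1))
        = ∑ p ∈ Fintype.piFinset (fun _ => S), f p * increment
          (fun x => ∏ j, (if x j = p j then (1 : ℝ) else 0)) u
            (fun j => g (i j)) (fun j => g (i j + 1)) := by
    intro u i hi
    have hi' : ∀ j ∈ u, i j < N := fun j hj => by
      have := Fintype.mem_piFinset.1 hi j
      simpa [hj] using this
    rw [← increment_sum]
    refine Finset.sum_congr rfl fun v hv => ?_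
    rw [hff']
    intro j
    have hvu := Finset.mem_powerset.1 hv
    split_ifs with h1 h2
    · exact hgS _ (hi' j (hvu h1))
    · exact hgS _ (hi' j h2).le
    · exact hN ▸ hgS N le_rfl
  rw [hff' x hxS]
  simp only [hf']
  have hexp := fun p : Fin s → ℝ => hprod fun j y => if y = p j then (1 : ℝ) else 0
  simp only [hexp]
  simp only [Finset.mul_sum]
  rw [Finset.sum_comm]
  refine Finset.sum_congr rfl fun u _ => ?_
  rw [Finset.sum_comm]
  refine Finset.sum_congr rfl fun i hi => ?_
  rw [hinc u i hi, Finset.mul_sum, Finset.mul_sum]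
  refine Finset.sum_congr rfl fun p _ => ?_
  ring

/-- The elements of a finite set with smallest element `0` and largest element `1`, enumerated
in increasing order. -/
lemma exists_grid (S : Finset ℝ) (hS : ∀ y ∈ S, y ∈ Set.Icc (0 : ℝ) 1) (h0 : (0 : ℝ) ∈ S)
    (h1 : (1 : ℝ) ∈ S) : ∃ (N : ℕ) (g : ℕ → ℝ), Monotone g ∧ StrictMonoOn g (Set.Iic N) ∧
      g 0 = 0 ∧ g N = 1 ∧ ∀ y ∈ S, ∃ a ≤ N, g a = y := by
  obtain ⟨N, hN⟩ : ∃ N, S.card = N + 1 :=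
    Nat.exists_eq_succ_of_ne_zero (Finset.card_ne_zero_of_mem h0)
  set o := S.orderEmbOfFin hN with ho
  have hmem : ∀ k, o k ∈ S := fun k => Finset.orderEmbOfFin_mem S hN k
  have hsurj : ∀ y ∈ S, ∃ k, o k = y := fun y hy => by
    have : y ∈ Set.range o := by rw [ho, Finset.range_orderEmbOfFin]; exact hy
    exact this
  have hlt : ∀ k, min k N < N + 1 := fun k => by omega
  refine ⟨N, fun k => o ⟨min k N, hlt k⟩, fun a b hab => o.monotone ?_,
    fun a ha b hb hab => o.strictMono ?_, ?_, ?_, fun y hy => ?_⟩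
  · simp only [Fin.mk_le_mk]; omega
  · simp only [Fin.mk_lt_mk, Set.mem_Iic] at *; omega
  · obtain ⟨k, hk⟩ := hsurj 0 h0
    refine le_antisymm ?_ (hS _ (hmem _)).1
    rw [← hk]
    exact o.monotone (by simp)
  · obtain ⟨k, hk⟩ := hsurj 1 h1
    refine le_antisymm (hS _ (hmem _)).2 ?_
    rw [← hk]
    exact o.monotone (by simp only [Fin.le_def]; omega)
  · obtain ⟨k, hk⟩ := hsurj y hy
    refine ⟨k, by omega, ?_⟩
    rw [← hk]
    have : (⟨min (k : ℕ) N, hlt k⟩ : Fin (N + 1)) = k := Fin.ext (by simp only; omega)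
    exact congrArg o this

/-- The Koksma–Hlawka inequality for finitely many points with weights of total mass zero. It is
enough to bound the local discrepancies at points with irrational coordinates. -/
theorem ofReal_abs_sum_mul_le {s : ℕ} {ι : Type*} [Fintype ι] (f : (Fin s → ℝ) → ℝ) (w : ι → ℝ)
    (p : ι → Fin s → ℝ) (hp : ∀ i, p i ∈ cube s) (hw : ∑ i, w i = 0) (D : ℝ)
    (hD : ∀ (u : Finset (Fin s)) (z : Fin s → ℝ),
      (∀ j ∈ u, z j ∈ Set.Ioo (0 : ℝ) 1 ∧ Irrational (z j)) →
        |∑ i, if ∀ j ∈ u, p i j < z j then w i else 0| ≤ D) :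
    ENNReal.ofReal |∑ i, w i * f (p i)| ≤ hardyKrauseVariation f * ENNReal.ofReal D := by
  classical
  set S : Finset ℝ := insert 0 (insert 1 (Finset.univ.image fun q : ι × Fin s => p q.1 q.2))
    with hS
  obtain ⟨N, g, hmono, hg, h0, hN, hsurj⟩ := exists_grid S (by
    intro y hy
    simp only [hS, Finset.mem_insert, Finset.mem_image, Finset.mem_univ, true_and] at hy
    rcases hy with rfl | rfl | ⟨q, rfl⟩
    · simp
    · simp
    · exact ⟨(hp q.1).1 q.2, (hp q.1).2 q.2⟩) (by simp [hS]) (by simp [hS])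
  have hgrid : ∀ i j, ∃ a ≤ N, g a = p i j := fun i j => hsurj _ (by
    simp only [hS, Finset.mem_insert, Finset.mem_image, Finset.mem_univ, true_and]
    exact Or.inr (Or.inr ⟨(i, j), rfl⟩))
  set cells : Finset (Fin s) → Finset (Fin s → ℕ) := fun u =>
    Fintype.piFinset (fun j => if j ∈ u then Finset.range N else {0}) with hcells
  set inc : Finset (Fin s) → (Fin s → ℕ) → ℝ := fun u c =>
    increment f u (fun j => g (c j)) (fun j => g (c j + 1)) with hinc
  set loc : Finset (Fin s) → (Fin s → ℕ) → ℝ := fun u c =>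
    ∑ i, if ∀ j ∈ u, p i j ≤ g (c j) then w i else 0 with hloc
  have hlocD : ∀ u, ∀ c ∈ cells u, |loc u c| ≤ D := by
    intro u c hc
    have hc' : ∀ j ∈ u, c j < N := fun j hj => by
      have := Fintype.mem_piFinset.1 hc j
      simpa [hj] using this
    -- All point coordinates are knots, so none lies strictly between consecutive knots: testing `≤
    -- g (c j)` equals testing `< z` for any irrational `z` in the gap.
    have hz : ∀ j, ∃ z : ℝ, j ∈ u → Irrational z ∧ g (c j) < z ∧ z < g (c j + 1) := by
      intro j
      by_cases hj : j ∈ u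
      · have hlt : g (c j) < g (c j + 1) :=
          hg (Set.mem_Iic.2 (hc' j hj).le) (Set.mem_Iic.2 (hc' j hj)) (Nat.lt_succ_self _)
        obtain ⟨z, hz⟩ := exists_irrational_btwn hlt
        exact ⟨z, fun _ => hz⟩
      · exact ⟨0, fun h => absurd h hj⟩
    choose z hz using hz
    convert hD u z fun j hj => ⟨⟨?_, ?_⟩, (hz j hj).1⟩ using 2
    · refine Finset.sum_congr rfl fun i _ => ?_
      refine if_congr (forall₂_congr fun j hj => ?_) rfl rfl
      obtain ⟨a, ha, hax⟩ := hgrid i j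
      rw [← hax]
      refine ⟨fun h => h.trans_lt (hz j hj).2.1, fun h => hmono ?_⟩
      have := hmono.reflect_lt (h.trans (hz j hj).2.2)
      omega
    · exact (h0 ▸ hmono (Nat.zero_le _) : 0 ≤ g (c j)).trans_lt (hz j hj).2.1
    · exact (hz j hj).2.2.trans_le (hN ▸ hmono (hc' j hj))
  have hexp : ∑ i, w i * f (p i) = ∑ u : Finset (Fin s) with u.Nonempty,
      (-1) ^ u.card * ∑ c ∈ cells u, loc u c * inc u c := by
    have h1 : ∑ i, w i * f (p i)
        = ∑ u : Finset (Fin s), (-1) ^ u.card * ∑ c ∈ cells u, loc u c * inc u c := by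
      rw [Finset.sum_congr rfl fun i _ => by rw [eq_sum_increment f hg hN (p i) (hgrid i)]]
      simp only [Finset.mul_sum, hloc, Finset.sum_mul]
      rw [Finset.sum_comm]
      refine Finset.sum_congr rfl fun u _ => ?_
      rw [Finset.sum_comm]
      refine Finset.sum_congr rfl fun c _ => Finset.sum_congr rfl fun i _ => ?_
      split_ifs <;> simp only [hinc] <;> ring
    rw [h1, Finset.sum_filter]
    refine Finset.sum_congr rfl fun u _ => ?_
    split_ifs with hu
    · rfl
    -- The term of the empty set is the total weight times a value of `f`, and the total weight is
    -- zero.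
    · rw [Finset.not_nonempty_iff_eq_empty] at hu
      have : ∀ c, loc u c = 0 := fun c => by simp [hloc, hu, hw]
      simp [this]
  rw [hexp, hardyKrauseVariation, Finset.sum_mul]
  refine (ENNReal.ofReal_le_ofReal (Finset.abs_sum_le_sum_abs _ _)).trans ?_
  rw [ENNReal.ofReal_sum_of_nonneg fun _ _ => abs_nonneg _]
  refine Finset.sum_le_sum fun u _ => ?_
  rw [abs_mul, abs_pow, abs_neg, abs_one, one_pow, one_mul]
  calc ENNReal.ofReal |∑ c ∈ cells u, loc u c * inc u c|
      ≤ ENNReal.ofReal (∑ c ∈ cells u, |inc u c| * D) := by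
        refine ENNReal.ofReal_le_ofReal ((Finset.abs_sum_le_sum_abs _ _).trans ?_)
        refine Finset.sum_le_sum fun c hc => ?_
        rw [abs_mul, mul_comm]
        exact mul_le_mul_of_nonneg_left (hlocD u c hc) (abs_nonneg _)
    _ = (∑ c ∈ cells u, ENNReal.ofReal |inc u c|) * ENNReal.ofReal D := by
        rw [← Finset.sum_mul, ENNReal.ofReal_mul (Finset.sum_nonneg fun _ _ => abs_nonneg _),
          ENNReal.ofReal_sum_of_nonneg fun _ _ => abs_nonneg _]
    _ ≤ vitaliVariation f u * ENNReal.ofReal D := by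
        gcongr
        exact le_iSup₂_of_le N ⟨fun _ => g, fun _ => ⟨hmono, h0, hN⟩⟩ le_rfl

/-! ### Stratified points -/

/-- The half-open unit cube `[0,1)^s`. -/
def unitBox (s : ℕ) : Set (Fin s → ℝ) := Set.univ.pi fun _ => Set.Ico 0 1

lemma unitBox_ae_eq_cube (s : ℕ) : (unitBox s : Set (Fin s → ℝ)) =ᵐ[volume] cube s :=
  Measure.univ_pi_Ico_ae_eq_Icc

lemma measurableSet_unitBox (s : ℕ) : MeasurableSet (unitBox s) :=
  MeasurableSet.univ_pi fun _ => measurableSet_Ico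

lemma volume_cube (s : ℕ) : volume (cube s) = 1 := by
  simp [cube, Real.volume_Icc_pi]

lemma volume_unitBox (s : ℕ) : volume (unitBox s) = 1 := by
  rw [measure_congr (unitBox_ae_eq_cube s), volume_cube]

lemma abs_sub_setIntegral_le {α : Type*} [MeasurableSpace α] {μ : Measure α} {S : Set α}
    (hS : μ S = 1) {h : α → ℝ} (hh : IntegrableOn h S μ) {c B : ℝ}
    (hB : ∀ y ∈ S, |c - h y| ≤ B) : |c - ∫ y in S, h y ∂μ| ≤ B := by
  have hr : μ.real S = 1 := by simp [measureReal_def, hS]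
  have h1 := norm_setIntegral_le_of_norm_le_const (μ := μ) (f := fun y => c - h y)
    (by simp [hS]) hB
  have hconst : IntegrableOn (fun _ => c) S μ := integrableOn_const (by simp [hS])
  rw [integral_sub hconst hh, setIntegral_const, hr] at h1
  simpa using h1

/-- The point at relative position `y` in the cell with index `k` of the `K × … × K` grid. -/
noncomputable def stratifiedPoint {s : ℕ} (K : ℕ) (k : Fin s → Fin K) (y : Fin s → ℝ) :
    Fin s → ℝ :=
  (K : ℝ)⁻¹ • ((fun j => ((k j : ℕ) : ℝ)) + y)

/-- The cell with index `k` of the `K × … × K` grid. -/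
def gridCell {s : ℕ} (K : ℕ) (k : Fin s → Fin K) : Set (Fin s → ℝ) :=
  {x | (K : ℝ) • x - (fun j => ((k j : ℕ) : ℝ)) ∈ unitBox s}

lemma mem_gridCell {s K : ℕ} {k : Fin s → Fin K} {x : Fin s → ℝ} :
    x ∈ gridCell K k ↔ ∀ j, ((k j : ℕ) : ℝ) ≤ K * x j ∧ K * x j < (k j : ℕ) + 1 := by
  simp only [gridCell, unitBox, Set.mem_ofPred_eq, Set.mem_univ_pi, Set.mem_Ico, Pi.sub_apply,
    Pi.smul_apply, smul_eq_mul, sub_nonneg, sub_lt_iff_lt_add']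

lemma measurableSet_gridCell {s K : ℕ} (k : Fin s → Fin K) : MeasurableSet (gridCell K k) :=
  measurableSet_preimage (f := fun x : Fin s → ℝ => (K : ℝ) • x - (fun j => ((k j : ℕ) : ℝ)))
    (by fun_prop) (measurableSet_unitBox s)

lemma iUnion_gridCell {s K : ℕ} (hK : 0 < K) : ⋃ k : Fin s → Fin K, gridCell K k = unitBox s := by
  have hK' : (0 : ℝ) < K := by exact_mod_cast hK
  ext x
  simp only [Set.mem_iUnion, mem_gridCell, unitBox, Set.mem_univ_pi, Set.mem_Ico]
  constructor
  · rintro ⟨k, hk⟩ j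
    have h1 : (((k j : ℕ) : ℝ)) + 1 ≤ K := by exact_mod_cast (k j).2
    have h2 : (0 : ℝ) ≤ (k j : ℕ) := by positivity
    obtain ⟨h3, h4⟩ := hk j
    constructor <;> nlinarith
  · intro hx
    have h0 : ∀ j, 0 ≤ K * x j := fun j => mul_nonneg hK'.le (hx j).1
    refine ⟨fun j => ⟨⌊K * x j⌋₊, (Nat.floor_lt (h0 j)).2 ?_⟩, fun j =>
      ⟨Nat.floor_le (h0 j), Nat.lt_floor_add_one _⟩⟩
    nlinarith [(hx j).2]

lemma pairwise_disjoint_gridCell {s K : ℕ} :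
    Pairwise (Function.onFun Disjoint (fun k : Fin s → Fin K => gridCell K k)) := by
  intro k k' hkk'
  refine Set.disjoint_left.2 fun x hx hx' => hkk' (funext fun j => Fin.ext ?_)
  obtain ⟨h1, h2⟩ := mem_gridCell.1 hx j
  obtain ⟨h3, h4⟩ := mem_gridCell.1 hx' j
  have h5 : ((k j : ℕ) : ℝ) < (k' j : ℕ) + 1 := by linarith
  have h6 : ((k' j : ℕ) : ℝ) < (k j : ℕ) + 1 := by linarith
  norm_cast at h5 h6
  omega

lemma stratifiedPoint_mem_gridCell {s K : ℕ} (hK : 0 < K) {k : Fin s → Fin K} {y : Fin s → ℝ} :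
    stratifiedPoint K k y ∈ gridCell K k ↔ y ∈ unitBox s := by
  have hK' : (K : ℝ) ≠ 0 := by exact_mod_cast hK.ne'
  simp only [gridCell, stratifiedPoint, Set.mem_ofPred_eq, smul_inv_smul₀ hK', add_sub_cancel_left]

lemma stratifiedPoint_mem_cube {s K : ℕ} (hK : 0 < K) (k : Fin s → Fin K) {y : Fin s → ℝ}
    (hy : y ∈ unitBox s) : stratifiedPoint K k y ∈ cube s := by
  have h : stratifiedPoint K k y ∈ unitBox s := by
    rw [← iUnion_gridCell hK]
    exact Set.mem_iUnion.2 ⟨k, (stratifiedPoint_mem_gridCell hK).2 hy⟩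
  exact ⟨fun j => (h j trivial).1, fun j => (h j trivial).2.le⟩

lemma indicator_stratifiedPoint {s K : ℕ} (hK : 0 < K) (f : (Fin s → ℝ) → ℝ) (k : Fin s → Fin K) :
    (unitBox s).indicator (fun y => f (stratifiedPoint K k y))
      = fun y => (gridCell K k).indicator f (stratifiedPoint K k y) := by
  classical
  ext y
  rw [Set.indicator_apply, Set.indicator_apply]
  exact if_congr (stratifiedPoint_mem_gridCell hK).symm rfl rfl

lemma integrableOn_stratifiedPoint {s K : ℕ} (hK : 0 < K) {f : (Fin s → ℝ) → ℝ}
    (hf : IntegrableOn f (unitBox s)) (k : Fin s → Fin K) :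
    IntegrableOn (fun y => f (stratifiedPoint K k y)) (unitBox s) := by
  have hK' : (K : ℝ)⁻¹ ≠ 0 := by simpa using hK.ne'
  rw [← integrable_indicator_iff (measurableSet_unitBox s), indicator_stratifiedPoint hK]
  have h1 : Integrable ((gridCell K k).indicator f) := by
    rw [integrable_indicator_iff (measurableSet_gridCell k)]
    refine hf.mono_set ?_
    rw [← iUnion_gridCell hK]
    exact Set.subset_iUnion _ k
  exact (h1.comp_smul hK').comp_add_left (fun j => ((k j : ℕ) : ℝ))

/-- Change of variables from the unit box to a cell of volume `K ^ (-s)`, done on the whole space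
with indicators. -/
lemma setIntegral_stratifiedPoint {s K : ℕ} (hK : 0 < K) (f : (Fin s → ℝ) → ℝ)
    (k : Fin s → Fin K) :
    ∫ y in unitBox s, f (stratifiedPoint K k y) = K ^ s * ∫ x in gridCell K k, f x := by
  rw [← integral_indicator (measurableSet_unitBox s), indicator_stratifiedPoint hK,
    ← integral_indicator (measurableSet_gridCell k)]
  have h1 := integral_add_left_eq_self (μ := (volume : Measure (Fin s → ℝ)))
    (fun y => (gridCell K k).indicator f ((K : ℝ)⁻¹ • y)) (fun j => ((k j : ℕ) : ℝ))
  rw [Measure.integral_comp_inv_smul, Module.finrank_fin_fun, abs_of_nonneg (by positivity),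
    smul_eq_mul] at h1
  exact h1

/-- Averaging over the relative position, the stratified sample mean is unbiased. -/
lemma setIntegral_stratified_mean {s K : ℕ} (hK : 0 < K) {f : (Fin s → ℝ) → ℝ}
    (hf : IntegrableOn f (unitBox s)) :
    ∫ y in unitBox s, ∑ k : Fin s → Fin K, ((K : ℝ) ^ s)⁻¹ * f (stratifiedPoint K k y)
      = ∫ x in unitBox s, f x := by
  have hK' : (K : ℝ) ^ s ≠ 0 := by
    have : (K : ℝ) ≠ 0 := by exact_mod_cast hK.ne'
    positivity
  rw [integral_finsetSum _ fun k _ => (integrableOn_stratifiedPoint hK hf k).const_mul _]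
  simp only [integral_const_mul, setIntegral_stratifiedPoint hK, inv_mul_cancel_left₀ hK']
  rw [← integral_iUnion_fintype measurableSet_gridCell pairwise_disjoint_gridCell,
    iUnion_gridCell hK]
  intro k
  refine hf.mono_set ?_
  rw [← iUnion_gridCell hK]
  exact Set.subset_iUnion _ k

lemma abs_prod_sub_prod_le {ι : Type*} (T : Finset ι) {a b : ι → ℝ}
    (ha : ∀ j ∈ T, a j ∈ Set.Icc (0 : ℝ) 1) (hb : ∀ j ∈ T, b j ∈ Set.Icc (0 : ℝ) 1) :
    |∏ j ∈ T, a j - ∏ j ∈ T, b j| ≤ ∑ j ∈ T, |a j - b j| := by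
  classical
  induction T using Finset.induction_on with
  | empty => simp
  | insert j T hj ih =>
    rw [Finset.prod_insert hj, Finset.prod_insert hj, Finset.sum_insert hj]
    have ih' := ih (fun i hi => ha i (Finset.mem_insert_of_mem hi))
      (fun i hi => hb i (Finset.mem_insert_of_mem hi))
    have ha0 := ha j (Finset.mem_insert_self j T)
    have hB0 : 0 ≤ ∏ i ∈ T, b i :=
      Finset.prod_nonneg fun i hi => (hb i (Finset.mem_insert_of_mem hi)).1
    have hB1 : ∏ i ∈ T, b i ≤ 1 :=
      Finset.prod_le_one (fun i hi => (hb i (Finset.mem_insert_of_mem hi)).1)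
        fun i hi => (hb i (Finset.mem_insert_of_mem hi)).2
    calc |a j * ∏ i ∈ T, a i - b j * ∏ i ∈ T, b i|
        = |(a j - b j) * ∏ i ∈ T, b i + a j * (∏ i ∈ T, a i - ∏ i ∈ T, b i)| := by
          congr 1; ring
      _ ≤ |(a j - b j) * ∏ i ∈ T, b i| + |a j * (∏ i ∈ T, a i - ∏ i ∈ T, b i)| := abs_add_le _ _
      _ ≤ |a j - b j| + |∏ i ∈ T, a i - ∏ i ∈ T, b i| := by
          rw [abs_mul, abs_mul, abs_of_nonneg hB0, abs_of_nonneg ha0.1]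
          gcongr
          · exact mul_le_of_le_one_right (abs_nonneg _) hB1
          · exact mul_le_of_le_one_left (abs_nonneg _) ha0.2
      _ ≤ _ := by gcongr

/-- The count is exactly `⌈K * z - y⌉₊`, which is within `1` of `K * z`. -/
lemma abs_card_div_sub_le {K : ℕ} (hK : 0 < K) {y z : ℝ} (hy : y ∈ Set.Ico (0 : ℝ) 1)
    (hz : z ∈ Set.Ioo (0 : ℝ) 1) :
    |((Finset.univ.filter fun a : Fin K => (K : ℝ)⁻¹ * ((a : ℕ) + y) < z).card : ℝ) / K - z|
      ≤ 1 / K := by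
  have hK' : (0 : ℝ) < K := by exact_mod_cast hK
  have h1 : (Finset.univ.filter fun a : Fin K => (K : ℝ)⁻¹ * ((a : ℕ) + y) < z).card
      = ⌈K * z - y⌉₊ := by
    have h2 : ⌈K * z - y⌉₊ ≤ K := Nat.ceil_le.2 (by nlinarith [hz.2, hy.1])
    conv_rhs => rw [← min_eq_right h2, ← Fin.card_filter_val_lt]
    congr 1
    refine Finset.filter_congr fun a _ => ?_
    rw [Nat.lt_ceil, inv_mul_lt_iff₀ hK', lt_sub_iff_add_lt]
  have h3 : K * z - y ≤ ⌈K * z - y⌉₊ := Nat.le_ceil _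
  have h4 : (⌈K * z - y⌉₊ : ℝ) ≤ K * z + 1 := by
    rcases le_total 0 (K * z - y) with h | h
    · have := Nat.ceil_lt_add_one h
      linarith [hy.1]
    · rw [Nat.ceil_eq_zero.2 h]
      have := mul_pos hK' hz.1
      push_cast
      linarith
  rw [h1, div_sub' hK'.ne', abs_div, abs_of_pos hK', div_le_div_iff_of_pos_right hK', abs_le]
  constructor <;> linarith [hy.2]

/-- Local discrepancy of a stratified sample. -/
lemma stratified_discrepancy_le {s K : ℕ} (hK : 0 < K) {y : Fin s → ℝ} (hy : y ∈ unitBox s)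
    (u : Finset (Fin s)) {z : Fin s → ℝ} (hz : ∀ j ∈ u, z j ∈ Set.Ioo (0 : ℝ) 1) :
    |(∑ k : Fin s → Fin K, if ∀ j ∈ u, stratifiedPoint K k y j < z j then ((K : ℝ) ^ s)⁻¹ else 0)
      - ∏ j ∈ u, z j| ≤ s / K := by
  have hK' : (0 : ℝ) < K := by exact_mod_cast hK
  set c : Fin s → Finset (Fin K) := fun j =>
    Finset.univ.filter fun a : Fin K => j ∈ u → (K : ℝ)⁻¹ * ((a : ℕ) + y j) < z j with hc
  have h1 : (∑ k : Fin s → Fin K,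
      if ∀ j ∈ u, stratifiedPoint K k y j < z j then ((K : ℝ) ^ s)⁻¹ else 0)
      = ∏ j, ((c j).card : ℝ) / K := by
    rw [← Finset.sum_filter, Finset.sum_const, nsmul_eq_mul, Finset.prod_div_distrib,
      Finset.prod_const, Finset.card_univ, Fintype.card_fin, ← div_eq_mul_inv,
      ← Nat.cast_prod, ← Fintype.card_piFinset]
    congr 3
    ext k
    rw [Finset.mem_filter, Fintype.mem_piFinset]
    simp [hc, stratifiedPoint]
  have h2 : ∏ j ∈ u, z j = ∏ j, if j ∈ u then z j else 1 := by
    rw [Finset.prod_ite_mem, Finset.univ_inter]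
  rw [h1, h2]
  refine (abs_prod_sub_prod_le _ (fun j _ => ⟨by positivity, ?_⟩) fun j _ => ?_).trans ?_
  · rw [div_le_one hK']
    have := Finset.card_le_univ (c j)
    rw [Fintype.card_fin] at this
    exact_mod_cast this
  · split_ifs with hj
    · exact ⟨(hz j hj).1.le, (hz j hj).2.le⟩
    · simp
  · have h3 : ∀ j, |((c j).card : ℝ) / K - if j ∈ u then z j else 1| ≤ 1 / K := by
      intro j
      by_cases hj : j ∈ u
      · simp only [hc, hj, true_imp_iff, if_true]
        exact abs_card_div_sub_le hK (hy j trivial) (hz j hj)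
      · simp [hc, hj, hK'.ne']
    refine (Finset.sum_le_sum fun j _ => h3 j).trans (le_of_eq ?_)
    simp [div_eq_mul_inv]

/-! ### The worst case error -/

/-- The Koksma–Hlawka inequality for equally weighted points. -/
theorem ofReal_abs_mean_sub_integral_le {s : ℕ} {ι : Type*} [Fintype ι] [Nonempty ι]
    {f : (Fin s → ℝ) → ℝ} (hf : IntegrableOn f (cube s)) (p : ι → Fin s → ℝ)
    (hp : ∀ i, p i ∈ cube s) {D : ℝ} (hD0 : 0 ≤ D)
    (hD : ∀ (u : Finset (Fin s)) (z : Fin s → ℝ),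
      (∀ j ∈ u, z j ∈ Set.Ioo (0 : ℝ) 1 ∧ Irrational (z j)) →
        |((Finset.univ.filter fun i => ∀ j ∈ u, p i j < z j).card : ℝ) / Fintype.card ι
          - ∏ j ∈ u, z j| ≤ D)
    (hV : hardyKrauseVariation f ≠ ∞) :
    ENNReal.ofReal |(Fintype.card ι : ℝ)⁻¹ * ∑ i, f (p i) - ∫ x in cube s, f x|
      ≤ hardyKrauseVariation f * ENNReal.ofReal D := by
  set V := (hardyKrauseVariation f).toReal with hVdef
  set c := (Fintype.card ι : ℝ)⁻¹ * ∑ i, f (p i) with hc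
  have hn : (Fintype.card ι : ℝ) ≠ 0 := by exact_mod_cast Fintype.card_ne_zero
  have hfb : IntegrableOn f (unitBox s) := hf.congr_set_ae (unitBox_ae_eq_cube s)
  rw [← setIntegral_congr_set (unitBox_ae_eq_cube s)]
  -- For each offset `y` the net mean is compared with the stratified mean: opposite weights have
  -- total mass zero and the discrepancies add. Averaging over `y` gives the integral exactly, and
  -- the extra `s / K` vanishes as `K → ∞`.
  have hbound : ∀ K : ℕ, 0 < K → |c - ∫ x in unitBox s, f x| ≤ V * (D + s / K) := by
    intro K hK
    have hK' : (K : ℝ) ^ s ≠ 0 := by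
      have : (K : ℝ) ≠ 0 := by exact_mod_cast hK.ne'
      positivity
    rw [← setIntegral_stratified_mean hK hfb]
    refine abs_sub_setIntegral_le (volume_unitBox s)
      (integrable_finsetSum _ fun k _ => (integrableOn_stratifiedPoint hK hfb k).const_mul _)
      fun y hy => ?_
    have key := ofReal_abs_sum_mul_le (ι := ι ⊕ (Fin s → Fin K)) f
      (Sum.elim (fun _ => (Fintype.card ι : ℝ)⁻¹) fun _ => -((K : ℝ) ^ s)⁻¹)
      (Sum.elim p fun k => stratifiedPoint K k y)
      (by
        rintro (i | k)
        · exact hp i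
        · exact stratifiedPoint_mem_cube hK k hy)
      (by simp [hn, hK'])
      (D + s / K)
      (by
        intro u z hz
        have h1 := hD u z hz
        have h2 := stratified_discrepancy_le hK hy u fun j hj => (hz j hj).1
        rw [Fintype.sum_sum_type]
        change |(∑ i, if ∀ j ∈ u, p i j < z j then (Fintype.card ι : ℝ)⁻¹ else 0)
          + ∑ k : Fin s → Fin K,
              if ∀ j ∈ u, stratifiedPoint K k y j < z j then -((K : ℝ) ^ s)⁻¹ else 0| ≤ _
        have h3 : (∑ i, if ∀ j ∈ u, p i j < z j then (Fintype.card ι : ℝ)⁻¹ else 0)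
            = ((Finset.univ.filter fun i => ∀ j ∈ u, p i j < z j).card : ℝ) / Fintype.card ι := by
          rw [← Finset.sum_filter, Finset.sum_const, nsmul_eq_mul, div_eq_mul_inv]
        have h4 : (∑ k : Fin s → Fin K,
              if ∀ j ∈ u, stratifiedPoint K k y j < z j then -((K : ℝ) ^ s)⁻¹ else 0)
            = -∑ k : Fin s → Fin K,
              if ∀ j ∈ u, stratifiedPoint K k y j < z j then ((K : ℝ) ^ s)⁻¹ else 0 := by
          rw [← Finset.sum_neg_distrib]
          refine Finset.sum_congr rfl fun k _ => ?_
          split_ifs <;> simp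
        rw [h3, h4]
        rw [abs_le] at h1 h2 ⊢
        constructor <;> linarith [h1.1, h1.2, h2.1, h2.2])
    rw [Fintype.sum_sum_type] at key
    simp only [Sum.elim_inl, Sum.elim_inr, neg_mul, Finset.sum_neg_distrib, ← sub_eq_add_neg,
      ← Finset.mul_sum (f := fun i => f (p i))] at key
    rw [← ENNReal.ofReal_toReal hV, ← ENNReal.ofReal_mul ENNReal.toReal_nonneg] at key
    exact (ENNReal.ofReal_le_ofReal_iff (by positivity)).1 key
  have hlim : Filter.Tendsto (fun K : ℕ => V * (D + s / K)) Filter.atTop (nhds (V * (D + 0))) :=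
    ((tendsto_const_div_atTop_nhds_zero_nat (s : ℝ)).const_add D).const_mul V
  have hfin : |c - ∫ x in unitBox s, f x| ≤ V * (D + 0) :=
    ge_of_tendsto hlim (Filter.eventually_atTop.2 ⟨1, fun K hK => hbound K hK⟩)
  rw [add_zero] at hfin
  rw [← ENNReal.ofReal_toReal hV, ← ENNReal.ofReal_mul ENNReal.toReal_nonneg]
  exact ENNReal.ofReal_le_ofReal hfin

lemma ofReal_abs_mean_sub_integral_le_oscillation {s : ℕ} {ι : Type*} [Fintype ι] [Nonempty ι]
    {f : (Fin s → ℝ) → ℝ} (hf : IntegrableOn f (cube s)) (p : ι → Fin s → ℝ)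
    (hp : ∀ i, p i ∈ cube s) :
    ENNReal.ofReal |(Fintype.card ι : ℝ)⁻¹ * ∑ i, f (p i) - ∫ x in cube s, f x|
      ≤ oscillation f := by
  rcases eq_or_ne (oscillation f) ∞ with htop | htop
  · simp [htop]
  have hn : (0 : ℝ) < Fintype.card ι := by exact_mod_cast Fintype.card_pos
  have hosc : ∀ x ∈ cube s, ∀ y ∈ cube s, f x - f y ≤ (oscillation f).toReal := by
    intro x hx y hy
    have h : ENNReal.ofReal (f x - f y) ≤ oscillation f :=
      (le_iSup₂_of_le x hx (le_iSup₂_of_le y hy le_rfl))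
    exact (ENNReal.ofReal_le_iff_le_toReal htop).1 h
  rw [ENNReal.ofReal_le_iff_le_toReal htop]
  refine abs_sub_setIntegral_le (volume_cube s) hf fun y hy => ?_
  -- For fixed `y` the error is an average of differences of two values of `f`, each bounded by the
  -- oscillation.
  have h1 : (Fintype.card ι : ℝ)⁻¹ * ∑ i, f (p i) - f y
      = (Fintype.card ι : ℝ)⁻¹ * ∑ i, (f (p i) - f y) := by
    rw [Finset.sum_sub_distrib, Finset.sum_const, Finset.card_univ, nsmul_eq_mul]
    field_simp
  rw [h1, abs_mul, abs_of_pos (inv_pos.2 hn), inv_mul_le_iff₀ hn]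
  refine (Finset.abs_sum_le_sum_abs _ _).trans ?_
  refine (Finset.sum_le_card_nsmul _ _ (oscillation f).toReal fun i _ => ?_).trans (le_of_eq ?_)
  · rw [abs_le]
    constructor <;> linarith [hosc _ (hp i) _ hy, hosc _ hy _ (hp i)]
  · rw [nsmul_eq_mul, Finset.card_univ]

/-- The error of the scrambled net estimate never exceeds the worst case bound. -/
theorem ofReal_abs_estimate_sub_le {s m t : ℕ} (hs : 1 ≤ s) {f : (Fin s → ℝ) → ℝ}
    (hf : IntegrableOn f (cube s)) {C : Fin s → Matrix (Fin m) (Fin m) (ZMod 2)}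
    (hC : IsDigitalNet t C) (M : Fin s → Matrix ℕ (Fin m) (ZMod 2)) (D : Fin s → ℕ → ZMod 2)
    (hupper : ∀ j (l : ℕ) (k : Fin m), l < k → M j l k = 0)
    (hdiag : ∀ j (k : Fin m), M j k k = 1) :
    ENNReal.ofReal |estimate f C M D - ∫ x in cube s, f x| ≤ errorBound t m f := by
  have : NeZero s := ⟨by omega⟩
  have htm : t ≤ m := IsNet.le hC
  have hp : ∀ i, scrambledPoint C M D i ∈ cube s := fun i =>
    ⟨fun j => digitValue_nonneg _, fun j => digitValue_le_one _⟩
  have hest : estimate f C M D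
      = (Fintype.card (Fin (2 ^ m)) : ℝ)⁻¹ * ∑ i, f (scrambledPoint C M D i) := by
    simp [estimate]
  rw [hest]
  refine le_min (ofReal_abs_mean_sub_integral_le_oscillation hf _ hp) ?_
  set B : ℝ := ∑ i ∈ Finset.range s, ((m - t).choose i : ℝ) with hB
  have hBpos : 0 < B := by
    have := Finset.single_le_sum (f := fun i => ((m - t).choose i : ℝ)) (fun _ _ => by positivity)
      (Finset.mem_range.2 hs)
    simp only [Nat.choose_zero_right, Nat.cast_one] at this
    linarith
  have hBE : ∑ i ∈ Finset.range s, ((m - t).choose i : ℝ≥0∞) = ENNReal.ofReal B := by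
    rw [hB, ENNReal.ofReal_sum_of_nonneg fun _ _ => by positivity]
    simp
  -- With infinite variation the bound is `∞`, because the binomial sum is positive and so `∞ * 0`
  -- does not arise.
  rcases eq_or_ne (hardyKrauseVariation f) ∞ with hV | hV
  · rw [hV, ENNReal.top_div_of_ne_top (by simp), hBE,
      ENNReal.top_mul (ENNReal.ofReal_pos.2 hBpos).ne']
    exact le_top
  have hpow : (2 : ℝ) ^ m = 2 ^ (m - t) * 2 ^ t := by rw [← pow_add, Nat.sub_add_cancel htm]
  refine (ofReal_abs_mean_sub_integral_le hf _ hp (D := B / 2 ^ (m - t)) (by positivity) ?_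
    hV).trans (le_of_eq ?_)
  · intro u z hz
    have h := (hC.digitNet_scrambled M D hupper hdiag).discrepancy_le u z hz
    rw [Nat.sub_add_cancel htm] at h
    have hcard : ∑ i ∈ Finset.range u.card, ((m - t).choose i : ℝ) ≤ B := by
      refine Finset.sum_le_sum_of_subset_of_nonneg ?_ fun _ _ _ => by positivity
      have := Finset.card_le_univ u
      rw [Fintype.card_fin] at this
      exact Finset.range_subset_range.2 this
    have h2m : (0 : ℝ) < 2 ^ m := by positivity
    rw [Fintype.card_fin, Nat.cast_pow, Nat.cast_ofNat, div_sub' h2m.ne', abs_div,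
      abs_of_pos h2m, div_le_iff₀ h2m]
    refine h.trans ?_
    rw [hpow, div_mul_eq_mul_div, le_div_iff₀ (by positivity)]
    nlinarith [mul_le_mul_of_nonneg_left hcard
      (show (0 : ℝ) ≤ 2 ^ (m - t) * 2 ^ t by positivity)]
  · rw [hBE, ENNReal.ofReal_div_of_pos (by positivity), ENNReal.ofReal_pow (by norm_num),
      ENNReal.ofReal_ofNat, div_eq_mul_inv, div_eq_mul_inv]
    ring

end MedianQMC

theorem mainTheorem8 {s m t r : ℕ} (hs : 1 ≤ s) (hr : 0 < r)
    (f : (Fin s → ℝ) → ℝ) (hf : MemLp f 2 (volume.restrict (MedianQMC.cube s)))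
    (C : Fin s → Matrix (Fin m) (Fin m) (ZMod 2)) (hC : MedianQMC.IsDigitalNet t C)
    {Ω : Type*} [MeasurableSpace Ω] (P : Measure Ω) [IsProbabilityMeasure P]
    (M : Ω → Fin s → Matrix ℕ (Fin m) (ZMod 2)) (D : Ω → Fin s → ℕ → ZMod 2)
    (hMD : MedianQMC.IsRandomLinearScramble P M D)
    (A : Set Ω) (hA : MeasurableSet A) (hA0 : P Aᶜ ≠ 0)
    (δ : ℝ) (hδ : 0 < δ) (hAδ : P A ≤ ENNReal.ofReal δ)
    (hunbiased : ∫ ω, MedianQMC.estimate f C (M ω) (D ω) ∂P[|Aᶜ]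
      = ∫ x in MedianQMC.cube s, f x)
    {Ω' : Type*} [MeasurableSpace Ω'] (P' : Measure Ω') [IsProbabilityMeasure P']
    (X : Fin (2 * r - 1) → Ω' → ℝ) (hXindep : iIndepFun X P')
    (hXlaw : ∀ k, IdentDistrib (X k) (fun ω => MedianQMC.estimate f C (M ω) (D ω)) P' P) :
    ∫⁻ ω, ENNReal.ofReal
        ((MedianQMC.sampleMedian hr (fun k => X k ω) - ∫ x in MedianQMC.cube s, f x) ^ 2) ∂P'
      ≤ P Aᶜ * evariance (fun ω => MedianQMC.estimate f C (M ω) (D ω)) P[|Aᶜ]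
          / ENNReal.ofReal δ
        + (8 * ENNReal.ofReal δ) ^ r * MedianQMC.errorBound t m f ^ 2 := by
  have hfin : IsFiniteMeasure (volume.restrict (MedianQMC.cube s)) :=
    ⟨by simp [MedianQMC.volume_cube]⟩
  have hint : IntegrableOn f (MedianQMC.cube s) := hf.integrable (by norm_num)
  exact MedianQMC.lintegral_sampleMedian_sq_le hr P _ hA hA0 (ENNReal.ofReal_pos.2 hδ).ne'
    ENNReal.ofReal_ne_top hAδ hunbiased
    (fun ω => MedianQMC.ofReal_abs_estimate_sub_le hs hint hC (M ω) (D ω) (hMD.upper ω)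
      (hMD.diag ω)) P' X hXindep hXlaw
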